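/- **Theorem 2.1.** Let $m,n\in\mathbb N$ and let $\Omega\subset\mathbb R^m$ be a bounded open set (for instance a bounded domain) with $C^3$ boundary $\partial\Omega$ and outward unit normal $\nu$. Let $T>0$, let $x_i^\circ\in\Omega$ and $v_i^\circ\in\mathbb R^m$, and let $F_i\in C([0,T]\times\overline\Omega^{\,n};\mathbb R^m)$, for $i=1,\dots,n$. Then there exists $X(t)=(x_1(t),\dots,x_n(t))$, $t\in[0,T]$, such that for every $i\in\{1,\dots,n\}$: 1. $x_i\in W^{1,\infty}(0,T;\mathbb R^m)$ (Lipschitz continuous representative on $[0,T]$), $x_i(t)\in\overline\Omega$ for all $t\in[0,T]$, the weak derivative satisfies $\dot x_i\in BV(0,T;\mathbb R^m)$, and has a representative with a right limit at every $t\in[0,T)$ and a left limit at every $t\in(0,T]$. Moreover $x_i(0)=x_i^\circ$, and the right derivative of $x_i$ at $0$ exists and satisfies $\frac{d^+x_i}{dt}(0)=v_i^\circ$. 2. Let $I^i_{\partial\Omega}:=\{t\in[0,T]: x_i(t)\in\partial\Omega\}$. There is a finite non-negative Borel measure $\rho_i$ on $(0,T)$ with $\operatorname{supp}\rho_i\subset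 I^i_{\partial\Omega}$ such that $\ddot x_i=F_i(t,X(t))-\rho_i\,\nu(x_i)$ in the sense of distributions, i.e. for every $\psi\in C_0^\infty(0,T;\mathbb R^m)$, $$-\int_0^T\dot x_i(t)\cdot\dot\psi(t)\,dt=\int_0^T F_i(t,X(t))\cdot\psi(t)\,dt-\int_{I^i_{\partial\Omega}}\nu(x_i(t))\cdot\psi(t)\,d\rho_i(t).$$ 3. For every $t\in I^i_{\partial\Omega}\cap(0,T)$ the left derivative $\frac{d^-x_i}{dt}(t)$ and the right derivative $\frac{d^+x_i}{dt}(t)$ exist and satisfy the reflection rule $$\frac{d^+x_i}{dt}(t)=\frac{d^-x_i}{dt}(t)-2\Big(\frac{d^-x_i}{dt}(t)\cdot\nu(x_i(t))\Big)\nu(x_i(t)).$$ -/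

import Mathlib

open Set Filter Topology MeasureTheory
open scoped ContDiff Gradient

/-- `φ` is a `C³` defining function of `Ω` on the open neighbourhood `U` of `p`:
`∇φ ≠ 0` on `U`, `Ω ∩ U = {φ < 0}` and `∂Ω ∩ U = {φ = 0}`. -/
structure IsLocalDefiningFunction {m : ℕ} (Ω : Set (EuclideanSpace ℝ (Fin m)))
    (p : EuclideanSpace ℝ (Fin m)) (U : Set (EuclideanSpace ℝ (Fin m)))
    (φ : EuclideanSpace ℝ (Fin m) → ℝ) : Prop where
  isOpen : IsOpen U
  mem : p ∈ U
  contDiffOn : ContDiffOn ℝ 3 φ U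
  gradient_ne_zero : ∀ x ∈ U, ∇ φ x ≠ 0
  mem_iff : ∀ x ∈ U, x ∈ Ω ↔ φ x < 0
  mem_frontier_iff : ∀ x ∈ U, x ∈ frontier Ω ↔ φ x = 0

/-- The boundary of `Ω` is of class `C³`. -/
def HasC3Boundary {m : ℕ} (Ω : Set (EuclideanSpace ℝ (Fin m))) : Prop :=
  ∀ p ∈ frontier Ω, ∃ U φ, IsLocalDefiningFunction Ω p U φ

/-- `v` is the outward unit normal of `Ω` at the boundary point `p`, that is
`v = ∇φ(p) / |∇φ(p)|` for a local defining function `φ` (negative inside `Ω`). -/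
def IsOutwardUnitNormal {m : ℕ} (Ω : Set (EuclideanSpace ℝ (Fin m)))
    (p v : EuclideanSpace ℝ (Fin m)) : Prop :=
  p ∈ frontier Ω ∧
    ∃ U φ, IsLocalDefiningFunction Ω p U φ ∧ v = ‖∇ φ p‖⁻¹ • ∇ φ p

/-- The outward unit normal does not depend on the local defining function. -/
theorem IsOutwardUnitNormal.unique {m : ℕ} {Ω : Set (EuclideanSpace ℝ (Fin m))}
    {p v w : EuclideanSpace ℝ (Fin m)} (hv : IsOutwardUnitNormal Ω p v)
    (hw : IsOutwardUnitNormal Ω p w) : v = w := by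
  obtain ⟨hp, U, φ, hφ, rfl⟩ := hv
  obtain ⟨-, V, χ, hχ, rfl⟩ := hw
  have key : ∀ (U : Set (EuclideanSpace ℝ (Fin m))) (φ : EuclideanSpace ℝ (Fin m) → ℝ),
      IsLocalDefiningFunction Ω p U φ → ∀ w : EuclideanSpace ℝ (Fin m),
        HasDerivAt (fun t : ℝ => φ (p + t • w)) (inner ℝ (∇ φ p) w) 0 ∧ φ p = 0 ∧
          ∀ᶠ t in 𝓝 (0 : ℝ), p + t • w ∈ U := by
    intro U φ h w
    have hd : DifferentiableAt ℝ φ p :=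
      (h.contDiffOn.contDiffAt (h.isOpen.mem_nhds h.mem)).differentiableAt (by norm_num)
    have hline : HasDerivAt (fun t : ℝ => p + t • w) w 0 := by
      simpa using ((hasDerivAt_id (0 : ℝ)).smul_const w).const_add p
    refine ⟨?_, (h.mem_frontier_iff p h.mem).1 hp, ?_⟩
    · have h1 : HasFDerivAt φ (InnerProductSpace.toDual ℝ _ (∇ φ p)) (p + (0 : ℝ) • w) := by
        rw [zero_smul, add_zero]
        exact hd.hasGradientAt.hasFDerivAt
      have h2 := h1.comp_hasDerivAt (0 : ℝ) hline
      rw [InnerProductSpace.toDual_apply_apply] at h2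
      exact h2
    · have hc : ContinuousAt (fun t : ℝ => p + t • w) 0 := hline.continuousAt
      exact hc.eventually_mem (by simpa using h.isOpen.mem_nhds h.mem)
  have ha : 0 < ‖∇ φ p‖ := norm_pos_iff.2 (hφ.gradient_ne_zero p hφ.mem)
  have hb : 0 < ‖∇ χ p‖ := norm_pos_iff.2 (hχ.gradient_ne_zero p hχ.mem)
  set a := ‖∇ φ p‖⁻¹ • ∇ φ p with hadef
  set b := ‖∇ χ p‖⁻¹ • ∇ χ p with hbdef
  have na : ‖a‖ = 1 := by rw [hadef, norm_smul, norm_inv, norm_norm, inv_mul_cancel₀ ha.ne']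
  have nb : ‖b‖ = 1 := by rw [hbdef, norm_smul, norm_inv, norm_norm, inv_mul_cancel₀ hb.ne']
  by_contra hne
  have hlt : inner ℝ a b < 1 := (inner_lt_one_iff_real_of_norm_eq_one na nb).2 hne
  have hga : ∇ φ p = ‖∇ φ p‖ • a := by rw [hadef, smul_inv_smul₀ ha.ne']
  have hgb : ∇ χ p = ‖∇ χ p‖ • b := by rw [hbdef, smul_inv_smul₀ hb.ne']
  obtain ⟨d1, z1, e1⟩ := key U φ hφ (b - a)
  obtain ⟨d2, z2, e2⟩ := key V χ hχ (b - a)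
  have s1 : inner ℝ (∇ φ p) (b - a) < 0 := by
    rw [hga, real_inner_smul_left, inner_sub_right, real_inner_self_eq_norm_sq, na]
    exact mul_neg_of_pos_of_neg ha (by linarith)
  have s2 : 0 < inner ℝ (∇ χ p) (b - a) := by
    rw [hgb, real_inner_smul_left, inner_sub_right, real_inner_self_eq_norm_sq, nb,
      real_inner_comm]
    exact mul_pos hb (by linarith)
  have t1 := (hasDerivAt_iff_tendsto_slope.1 d1).eventually (gt_mem_nhds s1)
  have t2 := (hasDerivAt_iff_tendsto_slope.1 d2).eventually (lt_mem_nhds s2)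
  have hle : 𝓝[>] (0 : ℝ) ≤ 𝓝[≠] 0 := nhdsWithin_mono _ fun x hx => ne_of_gt hx
  obtain ⟨t, h1, h2, u1, u2, ht⟩ := ((t1.filter_mono hle).and ((t2.filter_mono hle).and
    ((e1.filter_mono nhdsWithin_le_nhds).and ((e2.filter_mono nhdsWithin_le_nhds).and
      self_mem_nhdsWithin)))).exists
  have ht : (0 : ℝ) < t := ht
  simp only [slope_def_field, zero_smul, add_zero, sub_zero, z1, z2] at h1 h2
  have q1 : φ (p + t • (b - a)) < 0 := by
    by_contra hq
    exact absurd (div_nonneg (not_lt.1 hq) ht.le) (not_le.2 h1)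
  have q2 := (hχ.mem_iff _ u2).1 ((hφ.mem_iff _ u1).2 q1)
  exact absurd (div_neg_of_neg_of_pos q2 ht) (not_lt.2 h2.le)

open Classical in
/-- The outward unit normal field `ν` on `∂Ω` (and `0` where there is none). -/
noncomputable def outwardNormal {m : ℕ} (Ω : Set (EuclideanSpace ℝ (Fin m)))
    (p : EuclideanSpace ℝ (Fin m)) : EuclideanSpace ℝ (Fin m) :=
  if h : ∃ v, IsOutwardUnitNormal Ω p v then h.choose else 0

theorem outwardNormal_spec {m : ℕ} {Ω : Set (EuclideanSpace ℝ (Fin m))} (hΩ : HasC3Boundary Ω)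
    {p : EuclideanSpace ℝ (Fin m)} (hp : p ∈ frontier Ω) :
    IsOutwardUnitNormal Ω p (outwardNormal Ω p) := by
  have h : ∃ v, IsOutwardUnitNormal Ω p v := by
    obtain ⟨U, φ, hφ⟩ := hΩ p hp
    exact ⟨_, hp, U, φ, hφ, rfl⟩
  rw [outwardNormal, dif_pos h]
  exact h.choose_spec

/-- `ψ ∈ C₀^∞(0,T; ℝᵐ)`. -/
def IsTestFunction {m : ℕ} (T : ℝ) (ψ : ℝ → EuclideanSpace ℝ (Fin m)) : Prop :=
  ContDiff ℝ ∞ ψ ∧ HasCompactSupport ψ ∧ tsupport ψ ⊆ Ioo 0 T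

/-- `u ∈ W^{1,∞}(0,T; ℝᵐ)` with weak derivative (represented by) `v`, where `u` is the
Lipschitz continuous representative, taken on `[0,T]`. -/
structure IsW1InftyWithDeriv {m : ℕ} (T : ℝ) (u v : ℝ → EuclideanSpace ℝ (Fin m)) : Prop where
  memLp : MemLp u ⊤ (volume.restrict (Ioo 0 T))
  memLp_deriv : MemLp v ⊤ (volume.restrict (Ioo 0 T))
  weak_deriv : ∀ ψ, IsTestFunction T ψ →
    ∫ t in Ioo 0 T, inner ℝ (u t) (deriv ψ t) = -∫ t in Ioo 0 T, inner ℝ (v t) (ψ t)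
  lipschitz : ∃ K, LipschitzOnWith K u (Icc 0 T)

/-- `v ∈ BV(0,T; ℝᵐ)`: `v` is integrable and its distributional derivative has finite total
variation; moreover `v` is a representative that has a right limit at every point of `[0,T)`
and a left limit at every point of `(0,T]`. -/
structure IsBVRepresentative {m : ℕ} (T : ℝ) (v : ℝ → EuclideanSpace ℝ (Fin m)) : Prop where
  memLp : MemLp v 1 (volume.restrict (Ioo 0 T))
  variation : ∃ C : ℝ, ∀ ψ, IsTestFunction T ψ → (∀ t, ‖ψ t‖ ≤ 1) →
    ∫ t in Ioo 0 T, inner ℝ (v t) (deriv ψ t) ≤ C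
  right_limit : ∀ t ∈ Ico 0 T, ∃ l, Tendsto v (𝓝[>] t) (𝓝 l)
  left_limit : ∀ t ∈ Ioc 0 T, ∃ l, Tendsto v (𝓝[<] t) (𝓝 l)

/-- The contact times `{t ∈ [0,T] ; y(t) ∈ ∂Ω}` of a trajectory `y`. -/
def contactTimes {m : ℕ} (Ω : Set (EuclideanSpace ℝ (Fin m))) (T : ℝ)
    (y : ℝ → EuclideanSpace ℝ (Fin m)) : Set ℝ :=
  {t | t ∈ Icc 0 T ∧ y t ∈ frontier Ω}

/-- The reflection rule at time `t`: the one-sided derivatives of `y` at `t` exist and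
`y'(t+) = y'(t-) - 2 (y'(t-) · ν(y(t))) ν(y(t))`. -/
def SatisfiesReflectionRule {m : ℕ} (Ω : Set (EuclideanSpace ℝ (Fin m)))
    (y : ℝ → EuclideanSpace ℝ (Fin m)) (t : ℝ) : Prop :=
  ∃ vl vr, HasDerivWithinAt y vl (Iio t) t ∧ HasDerivWithinAt y vr (Ioi t) t ∧
    vr = vl - (2 * inner ℝ vl (outwardNormal Ω (y t))) • outwardNormal Ω (y t)

/-- The `i`-th trajectory of `x` satisfies the conditions of a solution, with velocity `v` and
reaction measure `ρ`. Here `ρ` is a finite measure on `(0,T)`, viewed as a measure on `ℝ` that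
is carried by `(0,T)`. The reflection rule is required at contact times in the open interval:
time `0` is not a contact time, and at time `T` there is no right derivative. -/
structure IsParticleSolution {m n : ℕ} (Ω : Set (EuclideanSpace ℝ (Fin m))) (T : ℝ)
    (F : Fin n → ℝ → (Fin n → EuclideanSpace ℝ (Fin m)) → EuclideanSpace ℝ (Fin m))
    (x₀ v₀ : Fin n → EuclideanSpace ℝ (Fin m)) (x : Fin n → ℝ → EuclideanSpace ℝ (Fin m))
    (i : Fin n) (v : ℝ → EuclideanSpace ℝ (Fin m)) (ρ : Measure ℝ) : Prop where
  w1infty : IsW1InftyWithDeriv T (x i) v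
  mem_closure : ∀ t ∈ Icc 0 T, x i t ∈ closure Ω
  bv : IsBVRepresentative T v
  initial_position : x i 0 = x₀ i
  initial_velocity : HasDerivWithinAt (x i) (v₀ i) (Ioi 0) 0
  finite : IsFiniteMeasure ρ
  carried : ρ (Ioo 0 T)ᶜ = 0
  support_subset : ρ.support ⊆ contactTimes Ω T (x i)
  weak_form : ∀ ψ, IsTestFunction T ψ →
    -∫ t in Ioo 0 T, inner ℝ (v t) (deriv ψ t) =
      (∫ t in Ioo 0 T, inner ℝ (F i t fun j => x j t) (ψ t)) -
        ∫ t in contactTimes Ω T (x i), inner ℝ (outwardNormal Ω (x i t)) (ψ t) ∂ρ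
  reflection : ∀ t ∈ contactTimes Ω T (x i), t ∈ Ioo 0 T → SatisfiesReflectionRule Ω (x i) t

/-- `x` is a solution of the reflected particle problem (only its values on `[0,T]` matter). -/
def IsSolution {m n : ℕ} (Ω : Set (EuclideanSpace ℝ (Fin m))) (T : ℝ)
    (F : Fin n → ℝ → (Fin n → EuclideanSpace ℝ (Fin m)) → EuclideanSpace ℝ (Fin m))
    (x₀ v₀ : Fin n → EuclideanSpace ℝ (Fin m))
    (x : Fin n → ℝ → EuclideanSpace ℝ (Fin m)) : Prop :=
  ∀ i, ∃ v ρ, IsParticleSolution Ω T F x₀ v₀ x i v ρ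

/-! ### A global defining function -/

/-! Solutions are limits of a time-stepping scheme. With a global `C²` defining function `φ` and `N
= ∇φ`, each step updates the velocity by the force, reflects it exactly along `N` if the particle
stands outside `Ω` and is heading outwards, and then moves the particle. Reflection preserves speed,
so velocities are bounded independently of the step `h`.

Three further estimates are uniform in `h`. Penetration satisfies `φ ≤ O(h)`, since the reflected
velocity points inwards (`definingFunction_le`). The total impulse is bounded, since each impulse
lowers the bounded quantity `N(x) · v` by a proportional amount (`totalImpulse_le`). Kinetic energy
varies at most linearly in time, whatever the impulses (`abs_energy_sub_le`).

Limits along a nonprincipal ultrafilter give positions, velocities and a monotone accumulated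
impulse `R` at all times at once (`exists_isImpactMotion`). The variation of the velocity is
dominated by that of `C t + R t`, so it has one-sided limits, which are the one-sided derivatives of
the position. The Stieltjes measure of `R` is the reaction; it lives on contact times because no
impulse occurs near an interior position.

At a contact time the velocity jumps by `-J ν` while its norm is unchanged, so `J` is zero or twice
the incoming normal component. As `φ(x) ≤ 0` with equality at contact, `J = 0` is possible only for
a tangential velocity, where reflection is trivial (`eq_reflection`). The weak form follows by
telescoping the momentum balance over fine partitions (`weak_form`). -/

theorem IsLocalDefiningFunction.at_point {m : ℕ} {Ω : Set (EuclideanSpace ℝ (Fin m))}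
    {p q : EuclideanSpace ℝ (Fin m)} {U : Set (EuclideanSpace ℝ (Fin m))}
    {φ : EuclideanSpace ℝ (Fin m) → ℝ} (h : IsLocalDefiningFunction Ω p U φ) (hq : q ∈ U) :
    IsLocalDefiningFunction Ω q U φ :=
  { h with mem := hq }

theorem IsLocalDefiningFunction.gradient_eq {m : ℕ} {Ω : Set (EuclideanSpace ℝ (Fin m))}
    (hΩ : HasC3Boundary Ω) {p q : EuclideanSpace ℝ (Fin m)}
    {U : Set (EuclideanSpace ℝ (Fin m))}
    {φ : EuclideanSpace ℝ (Fin m) → ℝ} (h : IsLocalDefiningFunction Ω p U φ) (hq : q ∈ U)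
    (hqf : q ∈ frontier Ω) : ∇ φ q = ‖∇ φ q‖ • outwardNormal Ω q := by
  have h1 : outwardNormal Ω q = ‖∇ φ q‖⁻¹ • ∇ φ q :=
    (outwardNormal_spec hΩ hqf).unique ⟨hqf, U, φ, h.at_point hq, rfl⟩
  rw [h1, smul_inv_smul₀ (norm_ne_zero_iff.2 (h.gradient_ne_zero q hq))]

theorem norm_outwardNormal {m : ℕ} {Ω : Set (EuclideanSpace ℝ (Fin m))}
    (hΩ : HasC3Boundary Ω) {p : EuclideanSpace ℝ (Fin m)} (hp : p ∈ frontier Ω) :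
    ‖outwardNormal Ω p‖ = 1 := by
  obtain ⟨-, U, φ, hφ, h⟩ := outwardNormal_spec hΩ hp
  rw [h, norm_smul, norm_inv, norm_norm,
    inv_mul_cancel₀ (norm_ne_zero_iff.2 (hφ.gradient_ne_zero p hφ.mem))]

/-- A local defining function, cut off by a bump function. -/
theorem exists_cutoff_definingFunction {m : ℕ} {Ω : Set (EuclideanSpace ℝ (Fin m))}
    (hΩ : HasC3Boundary Ω) {p : EuclideanSpace ℝ (Fin m)} (hp : p ∈ frontier Ω) :
    ∃ f χ : EuclideanSpace ℝ (Fin m) → ℝ, Continuous f ∧ f p = 1 ∧ ContDiff ℝ 2 χ ∧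
      (∀ x ∈ Ω, χ x ≤ 0) ∧ (∀ x ∉ Ω, 0 ≤ χ x) ∧
      ∀ q ∈ frontier Ω, χ q = 0 ∧ ∃ a : ℝ, 0 ≤ a ∧ (0 < f q → 0 < a) ∧
        HasFDerivAt χ (a • InnerProductSpace.toDual ℝ _ (outwardNormal Ω q)) q := by
  obtain ⟨U, φ, hφ⟩ := hΩ p hp
  obtain ⟨f, hfU, -, hf, hf01, hfp⟩ :=
    exists_contDiff_tsupport_subset (n := 2) (hφ.isOpen.mem_nhds hφ.mem)
  have hf0 : ∀ x, 0 ≤ f x := fun x => (hf01 ⟨x, rfl⟩).1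
  have hzero : ∀ x, x ∉ U → f x = 0 := fun x hx =>
    image_eq_zero_of_notMem_tsupport fun h => hx (hfU h)
  have hev : ∀ x, x ∉ U → f =ᶠ[𝓝 x] 0 := fun x hx =>
    notMem_tsupport_iff_eventuallyEq.1 fun h => hx (hfU h)
  refine ⟨f, fun x => f x * φ x, hf.continuous, hfp, ?_, ?_, ?_, ?_⟩
  · rw [contDiff_iff_contDiffAt]
    intro x
    by_cases hx : x ∈ U
    · exact hf.contDiffAt.mul
        ((hφ.contDiffOn.contDiffAt (hφ.isOpen.mem_nhds hx)).of_le (by norm_num))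
    · refine (contDiffAt_const (c := (0 : ℝ))).congr_of_eventuallyEq ?_
      filter_upwards [hev x hx] with y hy
      simp [hy]
  · intro x hx
    by_cases hU : x ∈ U
    · exact mul_nonpos_of_nonneg_of_nonpos (hf0 x) ((hφ.mem_iff x hU).1 hx).le
    · simp [hzero x hU]
  · intro x hx
    by_cases hU : x ∈ U
    · exact mul_nonneg (hf0 x) (not_lt.1 fun h => hx ((hφ.mem_iff x hU).2 h))
    · simp [hzero x hU]
  · intro q hq
    by_cases hU : q ∈ U
    · have hq0 : φ q = 0 := (hφ.mem_frontier_iff q hU).1 hq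
      -- As `φ q = 0`, the product rule leaves only `f q • ∇ φ q`: a nonnegative multiple of the
      -- normal, positive where the bump is. Such functions can be summed without cancellation.
      refine ⟨by simp [hq0], f q * ‖∇ φ q‖, mul_nonneg (hf0 q) (norm_nonneg _), fun h =>
        mul_pos h (norm_pos_iff.2 (hφ.gradient_ne_zero q hU)), ?_⟩
      have hd : DifferentiableAt ℝ φ q :=
        (hφ.contDiffOn.contDiffAt (hφ.isOpen.mem_nhds hU)).differentiableAt (by norm_num)
      have h1 := (hf.differentiable (by norm_num) q).hasFDerivAt.mul hd.hasGradientAt.hasFDerivAt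
      rw [hq0, zero_smul, add_zero, hφ.gradient_eq hΩ hU hq, map_smul, smul_smul] at h1
      exact h1
    · refine ⟨by simp [hzero q hU], 0, le_rfl, fun h => absurd (hzero q hU) h.ne', ?_⟩
      rw [zero_smul]
      refine (hasFDerivAt_const (0 : ℝ) q).congr_of_eventuallyEq ?_
      filter_upwards [hev q hU] with y hy
      simp [hy]

/-- A bounded open set with `C³` boundary has a global `C²` defining function. -/
theorem exists_definingFunction {m : ℕ} {Ω : Set (EuclideanSpace ℝ (Fin m))}
    (hb : Bornology.IsBounded Ω) (hΩ : HasC3Boundary Ω) :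
    ∃ φ : EuclideanSpace ℝ (Fin m) → ℝ, ContDiff ℝ 2 φ ∧ (∀ x ∈ Ω, φ x ≤ 0) ∧
      (∀ x ∉ closure Ω, 0 < φ x) ∧
      ∀ q ∈ frontier Ω, φ q = 0 ∧ ∃ a : ℝ, 0 < a ∧ ∇ φ q = a • outwardNormal Ω q := by
  have hex := fun p : frontier Ω => exists_cutoff_definingFunction hΩ p.2
  choose f χ hfc hfp hχ hneg hpos hfr using hex
  have hcomp : IsCompact (frontier Ω) :=
    hb.isCompact_closure.of_isClosed_subset isClosed_frontier frontier_subset_closure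
  obtain ⟨t, ht⟩ := hcomp.elim_nhds_subcover' (fun x hx => {y | 0 < f ⟨x, hx⟩ y}) fun x hx =>
    (isOpen_lt continuous_const (hfc ⟨x, hx⟩)).mem_nhds (by
      have := hfp ⟨x, hx⟩
      simp only [mem_ofPred_eq]
      linarith)
  -- The cut-off functions vanish away from the boundary, so a term positive exactly off `closure Ω`
  -- is added. It attains its minimum `0` on `closure Ω`, hence changes neither values nor gradients
  -- there.
  obtain ⟨η, hη, hηc, hη01⟩ :=
    (isClosed_closure (s := Ω)).isOpen_compl.exists_contDiff_support_eq (n := 2)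
  have hη0 : ∀ x, 0 ≤ η x := fun x => (hη01 ⟨x, rfl⟩).1
  have hηcl : ∀ x ∈ closure Ω, η x = 0 := fun x hx => by
    by_contra h
    have : x ∈ Function.support η := h
    rw [hη] at this
    exact this hx
  have hηd : ∀ x ∈ closure Ω, HasFDerivAt η (0 : EuclideanSpace ℝ (Fin m) →L[ℝ] ℝ) x := by
    intro x hx
    have h1 : IsLocalMin η x := Eventually.of_forall fun y => by
      rw [hηcl x hx]
      exact hη0 y
    rw [← h1.fderiv_eq_zero]
    exact (hηc.differentiable (by norm_num) x).hasFDerivAt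
  refine ⟨fun x => ∑ p ∈ t, χ p x + η x, (ContDiff.sum fun p _ => hχ p).add hηc, ?_, ?_, ?_⟩
  · intro x hx
    simp only [hηcl x (subset_closure hx), add_zero]
    exact Finset.sum_nonpos fun p _ => hneg p x hx
  · intro x hx
    have h1 : η x ≠ 0 := by
      have : x ∈ Function.support η := by
        rw [hη]
        exact hx
      exact this
    exact add_pos_of_nonneg_of_pos
      (Finset.sum_nonneg fun p _ => hpos p x fun h => hx (subset_closure h))
      (lt_of_le_of_ne (hη0 x) h1.symm)
  · intro q hq
    have hqc := frontier_subset_closure hq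
    refine ⟨?_, ?_⟩
    · simp only [hηcl q hqc, add_zero]
      exact Finset.sum_eq_zero fun p _ => (hfr p q hq).1
    choose a ha hfa hda using fun p => (hfr p q hq).2
    refine ⟨∑ p ∈ t, a p, ?_, ?_⟩
    · obtain ⟨p, hpt, hp⟩ := mem_iUnion₂.1 (ht hq)
      exact Finset.sum_pos' (fun p _ => ha p) ⟨p, hpt, hfa p hp⟩
    · have h1 := (HasFDerivAt.fun_sum fun p (_ : p ∈ t) => hda p).add (hηd q hqc)
      rw [add_zero, ← Finset.sum_smul, ← map_smul] at h1
      exact HasGradientAt.gradient h1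

/-- The quantitative information on a defining function `φ` with gradient `N` on a ball. -/
structure DefiningBounds {E : Type*} [NormedAddCommGroup E] [InnerProductSpace ℝ E] (Ω : Set E)
    (φ : E → ℝ) (N : E → E) (r L B c : ℝ) : Prop where
  L_nonneg : 0 ≤ L
  B_nonneg : 0 ≤ B
  c_pos : 0 < c
  nonpos : ∀ x ∈ Ω, φ x ≤ 0
  norm_le : ∀ x, ‖x‖ ≤ r → ‖N x‖ ≤ B
  lipschitz : ∀ x y, ‖x‖ ≤ r → ‖y‖ ≤ r → ‖N y - N x‖ ≤ L * ‖y - x‖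
  taylor : ∀ x y, ‖x‖ ≤ r → ‖y‖ ≤ r → φ y ≤ φ x + inner ℝ (N x) (y - x) + L * ‖y - x‖ ^ 2
  le_norm : ∀ x, ‖x‖ ≤ r → x ∉ Ω → φ x ≤ c → c ≤ ‖N x‖

theorem continuous_gradient {m : ℕ} {φ : EuclideanSpace ℝ (Fin m) → ℝ} (hφ : ContDiff ℝ 2 φ) :
    Continuous (∇ φ) :=
  (InnerProductSpace.toDual ℝ _).symm.continuous.comp (hφ.continuous_fderiv (by norm_num))

theorem exists_definingBounds {m : ℕ} {Ω : Set (EuclideanSpace ℝ (Fin m))}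
    (ho : IsOpen Ω) (hΩ : HasC3Boundary Ω) {φ : EuclideanSpace ℝ (Fin m) → ℝ}
    (hφ : ContDiff ℝ 2 φ) (hneg : ∀ x ∈ Ω, φ x ≤ 0) (hpos : ∀ x ∉ closure Ω, 0 < φ x)
    (hfr : ∀ q ∈ frontier Ω, φ q = 0 ∧ ∃ a : ℝ, 0 < a ∧ ∇ φ q = a • outwardNormal Ω q) (r : ℝ) :
    ∃ L B c, DefiningBounds Ω φ (∇ φ) r L B c := by
  have hNc : Continuous (∇ φ) := continuous_gradient hφ
  have hK : IsCompact (Metric.closedBall (0 : EuclideanSpace ℝ (Fin m)) r) :=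
    isCompact_closedBall _ _
  have hconv : Convex ℝ (Metric.closedBall (0 : EuclideanSpace ℝ (Fin m)) r) :=
    convex_closedBall _ _
  have hdd : Continuous (fderiv ℝ (fderiv ℝ φ)) :=
    (hφ.fderiv_right (m := 1) (by norm_num)).continuous_fderiv (by norm_num)
  have hd1 : Differentiable ℝ (fderiv ℝ φ) :=
    (hφ.fderiv_right (m := 1) (by norm_num)).differentiable (by norm_num)
  have hd : Differentiable ℝ φ := hφ.differentiable (by norm_num)
  obtain ⟨L, hL⟩ := hK.exists_bound_of_continuousOn (f := fderiv ℝ (fderiv ℝ φ)) hdd.continuousOn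
  obtain ⟨B, hB⟩ := hK.exists_bound_of_continuousOn hNc.continuousOn
  have hL' : ∀ x ∈ Metric.closedBall (0 : EuclideanSpace ℝ (Fin m)) r,
      ‖fderiv ℝ (fderiv ℝ φ) x‖ ≤ max L 0 := fun x hx => (hL x hx).trans (le_max_left _ _)
  have hlip : ∀ x y, ‖x‖ ≤ r → ‖y‖ ≤ r →
      ‖fderiv ℝ φ y - fderiv ℝ φ x‖ ≤ max L 0 * ‖y - x‖ := fun x y hx hy =>
    hconv.norm_image_sub_le_of_norm_fderiv_le (𝕜 := ℝ) (fun z _ => hd1 z) hL' (by simpa using hx)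
      (by simpa using hy)
  -- Off `Ω` the sum `φ + ‖∇ φ‖` is positive: on the boundary through the gradient, outside the
  -- closure through `φ`. By compactness it is at least some `2c`, so `φ ≤ c` leaves `‖∇ φ‖ ≥ c`.
  obtain ⟨c, hc0, hc⟩ : ∃ c > 0, ∀ x, ‖x‖ ≤ r → x ∉ Ω → φ x ≤ c → c ≤ ‖∇ φ x‖ := by
    have hK2 : IsCompact (Metric.closedBall (0 : EuclideanSpace ℝ (Fin m)) r \ Ω) := hK.diff ho
    have hpos' : ∀ x, x ∉ Ω → 0 < φ x + ‖∇ φ x‖ := by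
      intro x hx
      by_cases hcl : x ∈ closure Ω
      · have hxf : x ∈ frontier Ω := by
          rw [frontier, ho.interior_eq]
          exact ⟨hcl, hx⟩
        obtain ⟨h0, a, ha, hg⟩ := hfr x hxf
        rw [h0, hg, zero_add, norm_smul, norm_outwardNormal hΩ hxf, mul_one]
        exact norm_pos_iff.2 ha.ne'
      · exact add_pos_of_pos_of_nonneg (hpos x hcl) (norm_nonneg _)
    rcases (Metric.closedBall (0 : EuclideanSpace ℝ (Fin m)) r \ Ω).eq_empty_or_nonempty with
      he | hne
    · refine ⟨1, one_pos, fun x hx hxΩ => ?_⟩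
      have : x ∈ Metric.closedBall (0 : EuclideanSpace ℝ (Fin m)) r \ Ω :=
        ⟨by simpa using hx, hxΩ⟩
      rw [he] at this
      exact this.elim
    · obtain ⟨z, hz, hmin⟩ := hK2.exists_isMinOn hne
        ((hφ.continuous.add hNc.norm).continuousOn)
      refine ⟨(φ z + ‖∇ φ z‖) / 2, half_pos (hpos' z hz.2), fun x hx hxΩ hle => ?_⟩
      have := hmin (show x ∈ Metric.closedBall (0 : EuclideanSpace ℝ (Fin m)) r \ Ω from
        ⟨by simpa using hx, hxΩ⟩)
      simp only [mem_ofPred_eq, Pi.add_apply] at this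
      linarith
  refine ⟨max L 0, max B 0, c, le_max_right _ _, le_max_right _ _, hc0, hneg, ?_, ?_, ?_, hc⟩
  · exact fun x hx => (hB x (by simpa using hx)).trans (le_max_left _ _)
  · intro x y hx hy
    rw [gradient, gradient, ← map_sub, LinearIsometryEquiv.norm_map]
    exact hlip x y hx hy
  · intro x y hx hy
    have hseg : segment ℝ x y ⊆ Metric.closedBall (0 : EuclideanSpace ℝ (Fin m)) r :=
      hconv.segment_subset (by simpa using hx) (by simpa using hy)
    -- Mean value inequality for `φ` minus its linear part at `x`: along the segment the derivative
    -- differs from the one at `x` by at most `L * ‖y - x‖`.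
    have h1 := (convex_segment (𝕜 := ℝ) x y).norm_image_sub_le_of_norm_fderiv_le' (𝕜 := ℝ)
      (f := φ) (φ := fderiv ℝ φ x) (C := max L 0 * ‖y - x‖) (fun z _ => hd z) (fun z hz => by
        refine (hlip x z hx (by simpa using hseg hz)).trans ?_
        gcongr
        obtain ⟨a, ha, rfl⟩ := (segment_eq_image' ℝ x y ▸ hz)
        simp only [add_sub_cancel_left, norm_smul, Real.norm_eq_abs, abs_of_nonneg ha.1]
        exact mul_le_of_le_one_left (norm_nonneg _) ha.2)
      (left_mem_segment ℝ x y) (right_mem_segment ℝ x y)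
    have h2 : fderiv ℝ φ x (y - x) = inner ℝ (∇ φ x) (y - x) := by
      rw [← InnerProductSpace.toDual_apply_apply, toDual_gradient]
    rw [h2, Real.norm_eq_abs] at h1
    nlinarith [le_abs_self (φ y - φ x - inner ℝ (∇ φ x) (y - x))]

/-! ### The discrete reflection scheme -/

section Scheme

variable {E : Type*} [NormedAddCommGroup E] [InnerProductSpace ℝ E]

open Classical in
/-- The strength of the impulse received at position `x` with incoming velocity `w`. -/
noncomputable def impulse (Ω : Set E) (N : E → E) (x w : E) : ℝ :=
  if x ∈ Ω then 0 else 2 * max 0 (inner ℝ (N x) w) / ‖N x‖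

/-- The velocity after a possible reflection along `N x`. -/
noncomputable def bounce (Ω : Set E) (N : E → E) (x w : E) : E :=
  w - (impulse Ω N x w / ‖N x‖) • N x

theorem impulse_nonneg (Ω : Set E) (N : E → E) (x w : E) : 0 ≤ impulse Ω N x w := by
  unfold impulse
  split_ifs
  · exact le_rfl
  · positivity

theorem impulse_of_mem {Ω : Set E} (N : E → E) {x : E} (hx : x ∈ Ω) (w : E) :
    impulse Ω N x w = 0 := by
  simp [impulse, hx]

/-- When nonzero, the impulse is exactly the coefficient of the orthogonal reflection, so the cross
term and the square cancel. If `N x = 0`, nothing is subtracted. -/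
theorem norm_bounce (Ω : Set E) (N : E → E) (x w : E) : ‖bounce Ω N x w‖ = ‖w‖ := by
  unfold bounce impulse
  split_ifs with hx
  · simp
  by_cases hN : N x = 0
  · simp [hN]
  have hn : ‖N x‖ ≠ 0 := norm_ne_zero_iff.2 hN
  have h2 : ‖w - (2 * max 0 (inner ℝ (N x) w) / ‖N x‖ / ‖N x‖) • N x‖ ^ 2 = ‖w‖ ^ 2 := by
    rw [norm_sub_sq_real, norm_smul, inner_smul_right, real_inner_comm (N x) w, mul_pow,
      Real.norm_eq_abs, sq_abs]
    rcases le_total 0 (inner ℝ (N x) w) with h | h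
    · rw [max_eq_right h]
      field_simp
      ring
    · rw [max_eq_left h]
      simp
  exact (pow_left_inj₀ (norm_nonneg _) (norm_nonneg _) two_ne_zero).1 h2

theorem inner_bounce (Ω : Set E) (N : E → E) (x w : E) :
    inner ℝ (N x) (bounce Ω N x w) = inner ℝ (N x) w - impulse Ω N x w * ‖N x‖ := by
  by_cases hN : N x = 0
  · simp [hN]
  have hn : ‖N x‖ ≠ 0 := norm_ne_zero_iff.2 hN
  rw [bounce, inner_sub_right, inner_smul_right, real_inner_self_eq_norm_sq]
  field_simp

theorem inner_bounce_nonpos {Ω : Set E} (N : E → E) {x : E} (hx : x ∉ Ω) (w : E) :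
    inner ℝ (N x) (bounce Ω N x w) ≤ 0 := by
  rw [inner_bounce]
  by_cases hN : N x = 0
  · simp [hN]
  have hn : ‖N x‖ ≠ 0 := norm_ne_zero_iff.2 hN
  rw [impulse, if_neg hx, div_mul_cancel₀ _ hn]
  rcases le_total 0 (inner ℝ (N x) w) with h | h
  · rw [max_eq_right h]
    linarith
  · rw [max_eq_left h]
    linarith

/-- The discrete reflection scheme with step `h` and forces `f`. -/
structure IsBounceScheme (Ω : Set E) (N : E → E) (h : ℝ) (f x v : ℕ → E) : Prop where
  velocity : ∀ k, v (k + 1) = bounce Ω N (x k) (v k + h • f k)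
  position : ∀ k, x (k + 1) = x k + h • v (k + 1)

/-- The total impulse received in the first `k` steps of the scheme. -/
noncomputable def totalImpulse (Ω : Set E) (N : E → E) (h : ℝ) (f x v : ℕ → E) (k : ℕ) : ℝ :=
  ∑ j ∈ Finset.range k, impulse Ω N (x j) (v j + h • f j)

theorem totalImpulse_succ (Ω : Set E) (N : E → E) (h : ℝ) (f x v : ℕ → E) (k : ℕ) :
    totalImpulse Ω N h f x v (k + 1) =
      totalImpulse Ω N h f x v k + impulse Ω N (x k) (v k + h • f k) :=
  Finset.sum_range_succ _ _

theorem totalImpulse_mono (Ω : Set E) (N : E → E) (h : ℝ) (f x v : ℕ → E) :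
    Monotone (totalImpulse Ω N h f x v) :=
  monotone_nat_of_le_succ fun k => by
    rw [totalImpulse_succ]
    linarith [impulse_nonneg Ω N (x k) (v k + h • f k)]

theorem totalImpulse_eq_of_forall_mem {Ω : Set E} {N : E → E} {h : ℝ} {f x v : ℕ → E} {j k : ℕ}
    (hjk : j ≤ k) (hx : ∀ l, j ≤ l → l < k → x l ∈ Ω) :
    totalImpulse Ω N h f x v k = totalImpulse Ω N h f x v j := by
  induction k, hjk using Nat.le_induction with
  | base => rfl
  | succ k hk ih =>
    rw [totalImpulse_succ, ih fun l h1 h2 => hx l h1 (by omega),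
      impulse_of_mem N (hx k hk (by omega)), add_zero]

/-- The parameters of a run of the scheme on the time interval `[0,S]`. -/
structure IsBoundedScheme (Ω : Set E) (φ : E → ℝ) (N : E → E) (r L B c M V S h : ℝ)
    (f x v : ℕ → E) : Prop extends IsBounceScheme Ω N h f x v, DefiningBounds Ω φ N r L B c where
  h_pos : 0 < h
  h_le_one : h ≤ 1
  S_nonneg : 0 ≤ S
  M_nonneg : 0 ≤ M
  V_nonneg : 0 ≤ V
  force_le : ∀ k, ‖f k‖ ≤ M
  start_mem : x 0 ∈ Ω
  speed_le : ‖v 0‖ + M * S ≤ V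
  radius_le : ‖x 0‖ + V * S ≤ r
  small : (B * V + L * V ^ 2 + L * V ^ 2 * S) * h ≤ c

/-! ### A priori estimates uniform in the step size. -/

namespace IsBoundedScheme

variable {Ω : Set E} {φ : E → ℝ} {N : E → E} {r L B c M V S h : ℝ} {f x v : ℕ → E}

theorem norm_velocity_le (H : IsBoundedScheme Ω φ N r L B c M V S h f x v) {k : ℕ}
    (hk : k * h ≤ S) : ‖v k‖ ≤ V := by
  have h1 : ∀ k : ℕ, ‖v k‖ ≤ ‖v 0‖ + M * (k * h) := by
    intro k
    induction k with
    | zero => simp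
    | succ k ih =>
      rw [H.velocity, norm_bounce]
      refine (norm_add_le _ _).trans ?_
      rw [norm_smul, Real.norm_eq_abs, abs_of_pos H.h_pos]
      push_cast
      nlinarith [H.force_le k, H.h_pos]
  have := mul_le_mul_of_nonneg_left hk H.M_nonneg
  linarith [h1 k, H.speed_le]

theorem of_le (H : IsBoundedScheme Ω φ N r L B c M V S h f x v) {j k : ℕ} (hjk : j ≤ k)
    (hk : k * h ≤ S) : j * h ≤ S :=
  (mul_le_mul_of_nonneg_right (by exact_mod_cast hjk) H.h_pos.le).trans hk

theorem norm_position_sub_le (H : IsBoundedScheme Ω φ N r L B c M V S h f x v) {j k : ℕ}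
    (hjk : j ≤ k) (hk : k * h ≤ S) : ‖x k - x j‖ ≤ V * (k * h - j * h) := by
  induction k, hjk using Nat.le_induction with
  | base => simp
  | succ k hjk ih =>
    have h1 := ih (H.of_le (Nat.le_succ k) hk)
    have h2 : x (k + 1) - x j = (x k - x j) + h • v (k + 1) := by
      rw [H.position]
      abel
    rw [h2]
    refine (norm_add_le _ _).trans ?_
    rw [norm_smul, Real.norm_eq_abs, abs_of_pos H.h_pos]
    push_cast
    nlinarith [H.norm_velocity_le hk, H.h_pos]

theorem norm_position_le (H : IsBoundedScheme Ω φ N r L B c M V S h f x v) {k : ℕ}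
    (hk : k * h ≤ S) : ‖x k‖ ≤ r := by
  have h1 := H.norm_position_sub_le (Nat.zero_le k) hk
  have h2 : ‖x k‖ ≤ ‖x k - x 0‖ + ‖x 0‖ := by simpa using norm_add_le (x k - x 0) (x 0)
  have h3 := mul_le_mul_of_nonneg_left hk H.V_nonneg
  simp only [Nat.cast_zero, zero_mul, sub_zero] at h1
  linarith [H.radius_le]

/-- A step that starts in `Ω` begins with `φ ≤ 0` and raises it by at most `(B V + L V²) h`. A step
that starts outside has an inward velocity, so only the Taylor remainder `L V² h²` is added; over at
most `S / h` steps these remainders sum to `O(h)`. -/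
theorem definingFunction_le (H : IsBoundedScheme Ω φ N r L B c M V S h f x v) {k : ℕ}
    (hk : k * h ≤ S) : φ (x k) ≤ (B * V + L * V ^ 2 + L * V ^ 2 * S) * h := by
  have hLV : 0 ≤ L * V ^ 2 := mul_nonneg H.L_nonneg (sq_nonneg V)
  have hBV : 0 ≤ B * V := mul_nonneg H.B_nonneg H.V_nonneg
  have hh := H.h_pos
  have key : ∀ k : ℕ, k * h ≤ S →
      φ (x k) ≤ (B * V + L * V ^ 2) * h + L * V ^ 2 * h * (k * h) := by
    intro k
    induction k with
    | zero =>
      intro _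
      have := H.nonpos _ H.start_mem
      have : 0 ≤ (B * V + L * V ^ 2) * h := by positivity
      simp
      linarith
    | succ k ih =>
      intro hk1
      have hk0 := H.of_le (Nat.le_succ k) hk1
      have hv := H.norm_velocity_le hk1
      have h1 := H.taylor (x k) (x (k + 1)) (H.norm_position_le hk0) (H.norm_position_le hk1)
      rw [H.position k, add_sub_cancel_left, ← H.position k, inner_smul_right, norm_smul,
        Real.norm_eq_abs, abs_of_pos hh, mul_pow] at h1
      have h2 : L * (h ^ 2 * ‖v (k + 1)‖ ^ 2) ≤ L * V ^ 2 * h * h := by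
        have : ‖v (k + 1)‖ ^ 2 ≤ V ^ 2 := pow_le_pow_left₀ (norm_nonneg _) hv 2
        have := mul_le_mul_of_nonneg_left this (mul_nonneg H.L_nonneg (sq_nonneg h))
        nlinarith
      by_cases hxk : x k ∈ Ω
      · have h3 := H.nonpos _ hxk
        have h4 : inner ℝ (N (x k)) (v (k + 1)) ≤ B * V :=
          (real_inner_le_norm _ _).trans
            (mul_le_mul (H.norm_le _ (H.norm_position_le hk0)) hv (norm_nonneg _) H.B_nonneg)
        have h5 := mul_le_mul_of_nonneg_left h4 hh.le
        have h6 : L * V ^ 2 * h * h ≤ L * V ^ 2 * h * 1 :=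
          mul_le_mul_of_nonneg_left H.h_le_one (by positivity)
        have h7 : 0 ≤ L * V ^ 2 * h * (((k + 1 : ℕ) : ℝ) * h) := by positivity
        nlinarith
      · have h3 := ih hk0
        have h4 : inner ℝ (N (x k)) (v (k + 1)) ≤ 0 := by
          rw [H.velocity]
          exact inner_bounce_nonpos N hxk _
        have h5 := mul_nonpos_of_nonneg_of_nonpos hh.le h4
        push_cast
        nlinarith
  have h1 := key k hk
  have h2 := mul_le_mul_of_nonneg_left hk (mul_nonneg hLV hh.le)
  nlinarith

theorem le_norm_normal (H : IsBoundedScheme Ω φ N r L B c M V S h f x v) {k : ℕ}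
    (hk : k * h ≤ S) (hx : x k ∉ Ω) : c ≤ ‖N (x k)‖ :=
  H.le_norm _ (H.norm_position_le hk) hx ((H.definingFunction_le hk).trans H.small)

/-- The quantity `N(x k) · v k` stays within `±B V`. An impulse `p` lowers it by `p ‖N‖ ≥ c p`,
while the force and the variation of `N` raise it by at most `(B M + L V²) h` per step. Summation
bounds the impulses. -/
theorem totalImpulse_le (H : IsBoundedScheme Ω φ N r L B c M V S h f x v) {k : ℕ}
    (hk : k * h ≤ S) :
    totalImpulse Ω N h f x v k ≤ (2 * (B * V) + (L * V ^ 2 + B * M) * S) / c := by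
  have hh := H.h_pos
  have hBV : ∀ k : ℕ, k * h ≤ S → |inner ℝ (N (x k)) (v k)| ≤ B * V := fun k hk =>
    (abs_real_inner_le_norm _ _).trans
      (mul_le_mul (H.norm_le _ (H.norm_position_le hk)) (H.norm_velocity_le hk) (norm_nonneg _)
        H.B_nonneg)
  have key : ∀ k : ℕ, k * h ≤ S → c * totalImpulse Ω N h f x v k + inner ℝ (N (x k)) (v k) ≤
      inner ℝ (N (x 0)) (v 0) + (L * V ^ 2 + B * M) * (k * h) := by
    intro k
    induction k with
    | zero => simp [totalImpulse]
    | succ k ih =>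
      intro hk1
      have hk0 := H.of_le (Nat.le_succ k) hk1
      have h0 := ih hk0
      have hv := H.norm_velocity_le hk1
      rw [totalImpulse_succ]
      set p := impulse Ω N (x k) (v k + h • f k) with hp
      have h1 : c * p ≤ p * ‖N (x k)‖ := by
        by_cases hx : x k ∈ Ω
        · rw [hp, impulse_of_mem N hx]
          simp
        · rw [mul_comm]
          exact mul_le_mul_of_nonneg_left (H.le_norm_normal hk0 hx) (impulse_nonneg _ _ _ _)
      have h2 : inner ℝ (N (x k)) (v (k + 1)) =
          inner ℝ (N (x k)) (v k) + h * inner ℝ (N (x k)) (f k) - p * ‖N (x k)‖ := by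
        rw [H.velocity, inner_bounce, inner_add_right, inner_smul_right]
      have h3 : inner ℝ (N (x k)) (f k) ≤ B * M :=
        (real_inner_le_norm _ _).trans
          (mul_le_mul (H.norm_le _ (H.norm_position_le hk0)) (H.force_le k) (norm_nonneg _)
            H.B_nonneg)
      have h4 : inner ℝ (N (x (k + 1))) (v (k + 1)) - inner ℝ (N (x k)) (v (k + 1)) ≤
          L * (h * V) * V := by
        rw [← inner_sub_left]
        refine (real_inner_le_norm _ _).trans (mul_le_mul ?_ hv (norm_nonneg _)
          (mul_nonneg H.L_nonneg (mul_nonneg hh.le H.V_nonneg)))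
        refine (H.lipschitz _ _ (H.norm_position_le hk0) (H.norm_position_le hk1)).trans
          (mul_le_mul_of_nonneg_left ?_ H.L_nonneg)
        rw [H.position k, add_sub_cancel_left, norm_smul, Real.norm_eq_abs, abs_of_pos hh]
        exact mul_le_mul_of_nonneg_left hv hh.le
      have h5 := mul_le_mul_of_nonneg_left h3 hh.le
      push_cast
      nlinarith
  rw [le_div_iff₀ H.c_pos, mul_comm]
  have h1 := key k hk
  have h2 := (abs_le.1 (hBV k hk)).1
  have h3 := (abs_le.1 (hBV 0 (by simpa using H.S_nonneg))).2
  have h4 : (L * V ^ 2 + B * M) * (k * h) ≤ (L * V ^ 2 + B * M) * S :=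
    mul_le_mul_of_nonneg_left hk (add_nonneg (mul_nonneg H.L_nonneg (sq_nonneg V))
      (mul_nonneg H.B_nonneg H.M_nonneg))
  linarith

/-- One step of the scheme in terms of a field `n` that agrees with the unit normal wherever
`‖N‖ ≥ c`. -/
theorem velocity_succ (H : IsBoundedScheme Ω φ N r L B c M V S h f x v) {k : ℕ}
    (hk : k * h ≤ S) {n : E → E} (hn : ∀ y, c ≤ ‖N y‖ → n y = ‖N y‖⁻¹ • N y) :
    v (k + 1) = v k + h • f k - impulse Ω N (x k) (v k + h • f k) • n (x k) := by
  rw [H.velocity, bounce]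
  by_cases hx : x k ∈ Ω
  · simp [impulse_of_mem N hx]
  · rw [hn _ (H.le_norm_normal hk hx), smul_smul, div_eq_mul_inv]

/-- Momentum balance with force and normal frozen at `g` and `b`. The error is `ε` times elapsed
time plus received impulse, an additive quantity that survives both the limit and later telescoping.
-/
theorem norm_velocity_sub_add_le (H : IsBoundedScheme Ω φ N r L B c M V S h f x v)
    {n : E → E} (hn : ∀ y, c ≤ ‖N y‖ → n y = ‖N y‖⁻¹ • N y) {j k : ℕ} (hjk : j ≤ k)
    (hk : k * h ≤ S) {g b : E} {ε : ℝ} (hg : ∀ l, j ≤ l → l < k → ‖f l - g‖ ≤ ε)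
    (hb : ∀ l, j ≤ l → l < k → ‖n (x l) - b‖ ≤ ε) :
    ‖v k - v j - (k * h - j * h) • g +
        (totalImpulse Ω N h f x v k - totalImpulse Ω N h f x v j) • b‖ ≤
      ε * ((k * h - j * h) + (totalImpulse Ω N h f x v k - totalImpulse Ω N h f x v j)) := by
  induction k, hjk using Nat.le_induction with
  | base => simp
  | succ k hjk ih =>
    have hk0 := H.of_le (Nat.le_succ k) hk
    have h0 := ih hk0 (fun l h1 h2 => hg l h1 (by omega)) (fun l h1 h2 => hb l h1 (by omega))
    have h1 := hg k hjk (by omega)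
    have h2 := hb k hjk (by omega)
    rw [totalImpulse_succ, H.velocity_succ hk0 hn]
    set p := impulse Ω N (x k) (v k + h • f k) with hp
    have hp0 : 0 ≤ p := impulse_nonneg _ _ _ _
    set R := totalImpulse Ω N h f x v k - totalImpulse Ω N h f x v j with hR
    have h3 : totalImpulse Ω N h f x v k + p - totalImpulse Ω N h f x v j = R + p := by
      rw [hR]
      ring
    have h4 : ((k + 1 : ℕ) : ℝ) * h - j * h = (k * h - j * h) + h := by
      push_cast
      ring
    have h5 : v k + h • f k - p • n (x k) - v j - (k * h - j * h + h) • g + (R + p) • b =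
        (v k - v j - (k * h - j * h) • g + R • b) + h • (f k - g) - p • (n (x k) - b) := by
      module
    rw [h3, h4, h5]
    refine (norm_sub_le _ _).trans ((add_le_add_left (norm_add_le _ _) _).trans ?_)
    rw [norm_smul, norm_smul, Real.norm_eq_abs, Real.norm_eq_abs, abs_of_pos H.h_pos,
      abs_of_nonneg hp0]
    nlinarith [H.h_pos]

theorem norm_velocity_sub_le (H : IsBoundedScheme Ω φ N r L B c M V S h f x v) {j k : ℕ}
    (hjk : j ≤ k) (hk : k * h ≤ S) :
    ‖v k - v j‖ ≤ M * (k * h - j * h) +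
      (totalImpulse Ω N h f x v k - totalImpulse Ω N h f x v j) := by
  induction k, hjk using Nat.le_induction with
  | base => simp
  | succ k hjk ih =>
    have hk0 := H.of_le (Nat.le_succ k) hk
    have h0 := ih hk0
    rw [totalImpulse_succ, H.velocity, bounce]
    set p := impulse Ω N (x k) (v k + h • f k) with hp
    have hp0 : 0 ≤ p := impulse_nonneg _ _ _ _
    have h5 : v k + h • f k - (p / ‖N (x k)‖) • N (x k) - v j =
        (v k - v j) + h • f k - (p / ‖N (x k)‖) • N (x k) := by
      abel
    rw [h5]
    refine (norm_sub_le _ _).trans ((add_le_add_left (norm_add_le _ _) _).trans ?_)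
    have h6 : ‖(p / ‖N (x k)‖) • N (x k)‖ ≤ p := by
      rw [norm_smul, norm_div, norm_norm, Real.norm_eq_abs, abs_of_nonneg hp0]
      by_cases hN : ‖N (x k)‖ = 0
      · simp [hN, hp0]
      · rw [div_mul_cancel₀ _ hN]
    rw [norm_smul, Real.norm_eq_abs, abs_of_pos H.h_pos]
    push_cast
    nlinarith [H.h_pos, H.force_le k]

/-- Reflection preserves the norm, so only the terms `2 h v · f + h² ‖f‖²` of the force step
contribute. No impulse enters the bound, which is why impacts in the limit conserve energy. -/
theorem abs_energy_sub_le (H : IsBoundedScheme Ω φ N r L B c M V S h f x v) {j k : ℕ}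
    (hjk : j ≤ k) (hk : k * h ≤ S) :
    |‖v k‖ ^ 2 - ‖v j‖ ^ 2| ≤ (2 * V * M + M ^ 2) * (k * h - j * h) := by
  induction k, hjk using Nat.le_induction with
  | base => simp
  | succ k hjk ih =>
    have hk0 := H.of_le (Nat.le_succ k) hk
    have h0 := ih hk0
    have hh := H.h_pos
    have h1 : ‖v (k + 1)‖ ^ 2 = ‖v k‖ ^ 2 + 2 * (h * inner ℝ (v k) (f k)) + h ^ 2 * ‖f k‖ ^ 2 := by
      rw [H.velocity, norm_bounce, norm_add_sq_real, inner_smul_right, norm_smul, mul_pow,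
        Real.norm_eq_abs, sq_abs]
    have h2 : |inner ℝ (v k) (f k)| ≤ V * M := (abs_real_inner_le_norm _ _).trans
      (mul_le_mul (H.norm_velocity_le hk0) (H.force_le k) (norm_nonneg _) H.V_nonneg)
    have h3 : h ^ 2 * ‖f k‖ ^ 2 ≤ h * M ^ 2 := by
      have : ‖f k‖ ^ 2 ≤ M ^ 2 := pow_le_pow_left₀ (norm_nonneg _) (H.force_le k) 2
      have h4 : h ^ 2 ≤ h := by nlinarith [H.h_le_one]
      exact mul_le_mul h4 this (sq_nonneg _) hh.le
    have h3' : 0 ≤ h ^ 2 * ‖f k‖ ^ 2 := by positivity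
    obtain ⟨h5, h6⟩ := abs_le.1 h0
    obtain ⟨h7, h8⟩ := abs_le.1 h2
    have h9 := mul_le_mul_of_nonneg_left h7 hh.le
    have h10 := mul_le_mul_of_nonneg_left h8 hh.le
    rw [h1, abs_le]
    push_cast
    have hM2 : 0 ≤ M ^ 2 * h := by positivity
    constructor <;> nlinarith

theorem norm_position_taylor_le (H : IsBoundedScheme Ω φ N r L B c M V S h f x v) {j k : ℕ}
    (hjk : j ≤ k) (hk : k * h ≤ S) :
    ‖x k - x j - (k * h - j * h) • v j‖ ≤ (k * h - j * h) * (M * (k * h - j * h) +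
      (totalImpulse Ω N h f x v k - totalImpulse Ω N h f x v j)) := by
  have hh := H.h_pos
  -- The bracket stays at the final index `k` while `k'` runs: it dominates every velocity deviation
  -- on the way, by monotonicity of the total impulse.
  have key : ∀ k', j ≤ k' → k' ≤ k → ‖x k' - x j - (k' * h - j * h) • v j‖ ≤
      (k' * h - j * h) * (M * (k * h - j * h) +
        (totalImpulse Ω N h f x v k - totalImpulse Ω N h f x v j)) := by
    intro k' hjk'
    induction k', hjk' using Nat.le_induction with
    | base => simp
    | succ k' hjk' ih =>
      intro hk'
      have h0 := ih (by omega)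
      have h1 := H.norm_velocity_sub_le (j := j) (k := k' + 1) (by omega) (H.of_le hk' hk)
      have h2 : x (k' + 1) - x j - (((k' + 1 : ℕ) : ℝ) * h - j * h) • v j =
          (x k' - x j - (k' * h - j * h) • v j) + h • (v (k' + 1) - v j) := by
        rw [H.position]
        push_cast
        module
      have h3 := totalImpulse_mono Ω N h f x v hk'
      have h4 : ((k' + 1 : ℕ) : ℝ) ≤ k := by exact_mod_cast hk'
      have h5 : M * (((k' + 1 : ℕ) : ℝ) * h) ≤ M * (k * h) :=
        mul_le_mul_of_nonneg_left (mul_le_mul_of_nonneg_right h4 hh.le) H.M_nonneg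
      rw [h2]
      refine (norm_add_le _ _).trans ?_
      rw [norm_smul, Real.norm_eq_abs, abs_of_pos hh]
      have h6 : h * ‖v (k' + 1) - v j‖ ≤ h * (M * (k * h - j * h) +
          (totalImpulse Ω N h f x v k - totalImpulse Ω N h f x v j)) :=
        mul_le_mul_of_nonneg_left (by linarith) hh.le
      have h7 : ((k' + 1 : ℕ) : ℝ) * h - j * h = (k' * h - j * h) + h := by
        push_cast
        ring
      rw [h7, add_mul]
      linarith
  exact key k hjk le_rfl

end IsBoundedScheme

end Scheme

/-! ### The limit of the discrete schemes -/

/-- The index of the time step of length `h` in which `t`, projected to `[0,S]`, falls. -/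
noncomputable def stepIndex (S h t : ℝ) : ℕ := ⌊max 0 (min t S) / h⌋₊

theorem stepIndex_mono {S h : ℝ} (hh : 0 < h) : Monotone (stepIndex S h) := fun _ _ hst =>
  Nat.floor_mono (div_le_div_of_nonneg_right (max_le_max_left _ (min_le_min_right _ hst)) hh.le)

theorem stepIndex_mul_le_max {S h : ℝ} (hh : 0 < h) (t : ℝ) :
    stepIndex S h t * h ≤ max 0 (min t S) :=
  (le_div_iff₀ hh).1 (Nat.floor_le (div_nonneg (le_max_left _ _) hh.le))

theorem stepIndex_mul_le {S h : ℝ} (hS : 0 ≤ S) (hh : 0 < h) (t : ℝ) :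
    stepIndex S h t * h ≤ S :=
  (stepIndex_mul_le_max hh t).trans (max_le hS (min_le_right _ _))

theorem lt_stepIndex_mul_add {S h : ℝ} (hh : 0 < h) (t : ℝ) :
    max 0 (min t S) < stepIndex S h t * h + h := by
  have := (div_lt_iff₀ hh).1 (Nat.lt_floor_add_one (max 0 (min t S) / h))
  rw [stepIndex]
  linarith

theorem stepIndex_zero {S h : ℝ} (hS : 0 ≤ S) : stepIndex S h 0 = 0 := by
  simp [stepIndex, hS]

theorem stepIndex_sub_le {S h : ℝ} (hh : 0 < h) {s t : ℝ} (hst : s ≤ t) :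
    stepIndex S h t * h - stepIndex S h s * h ≤ t - s + h := by
  have h1 := stepIndex_mul_le_max (S := S) hh t
  have h2 := lt_stepIndex_mul_add (S := S) hh s
  have h3 : max 0 (min t S) ≤ max 0 (min s S) + (t - s) := by
    refine max_le (by linarith [le_max_left 0 (min s S)]) ?_
    rcases le_total s S with h | h
    · have := le_max_right 0 (min s S)
      rw [min_eq_left h] at this ⊢
      linarith [min_le_left t S]
    · have := le_max_right 0 (min s S)
      rw [min_eq_right h] at this ⊢
      linarith [min_le_right t S]
  linarith

theorem tendsto_stepIndex_mul {S : ℝ} {l : Filter ℕ} {h : ℕ → ℝ} (hh : ∀ ν, 0 < h ν)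
    (h0 : Tendsto h l (𝓝 0)) {t : ℝ} (ht : t ∈ Icc 0 S) :
    Tendsto (fun ν => stepIndex S (h ν) t * h ν) l (𝓝 t) := by
  have ht' : max 0 (min t S) = t := by rw [min_eq_left ht.2, max_eq_right ht.1]
  refine tendsto_of_tendsto_of_tendsto_of_le_of_le (g := fun ν => t - h ν) (h := fun _ => t)
    (by simpa using tendsto_const_nhds.sub h0) tendsto_const_nhds (fun ν => ?_) fun ν => ?_
  · have := lt_stepIndex_mul_add (S := S) (hh ν) t
    rw [ht'] at this
    simp only
    linarith
  · have := stepIndex_mul_le_max (S := S) (hh ν) t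
    rwa [ht'] at this

/-- The discrete sequences `y ν` follow the function `z`, locally uniformly in time. -/
def Tracks {Y : Type*} [PseudoMetricSpace Y] (l : Filter ℕ) (S : ℝ) (h : ℕ → ℝ) (y : ℕ → ℕ → Y)
    (z : ℝ → Y) : Prop :=
  ∀ ε > 0, ∃ δ > 0, ∀ s ∈ Icc 0 S, ∀ t ∈ Icc 0 S, s ≤ t → t - s < δ → ∀ᶠ ν in l,
    ∀ k, stepIndex S (h ν) s ≤ k → k < stepIndex S (h ν) t → dist (y ν k) (z s) < ε

/-- Only the limit has to stay in `K`: continuity at the points of a compact set is uniform even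
when compared with nearby points outside it. -/
theorem Tracks.comp {Y Z : Type*} [PseudoMetricSpace Y] [PseudoMetricSpace Z] {l : Filter ℕ}
    {S : ℝ} {h : ℕ → ℝ} {y : ℕ → ℕ → Y} {z : ℝ → Y} (H : Tracks l S h y z) {K : Set Y}
    (hK : IsCompact K) (hz : ∀ s ∈ Icc 0 S, z s ∈ K) {G : Y → Z} (hG : Continuous G) :
    Tracks l S h (fun ν k => G (y ν k)) fun s => G (z s) := by
  intro ε hε
  have h1 := hK.uniformContinuousAt_of_continuousAt G (fun a _ => hG.continuousAt)
    (Metric.dist_mem_uniformity hε)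
  obtain ⟨η, hη, h2⟩ := Metric.mem_uniformity_dist.1 h1
  obtain ⟨δ, hδ, h3⟩ := H η hη
  refine ⟨δ, hδ, fun s hs t ht hst hlt => ?_⟩
  filter_upwards [h3 s hs t ht hst hlt] with ν hν k hk1 hk2
  rw [dist_comm]
  exact h2 (by rw [dist_comm]; exact hν k hk1 hk2) (hz s hs)

theorem Tracks.prodMk {Y Z : Type*} [PseudoMetricSpace Y] [PseudoMetricSpace Z] {l : Filter ℕ}
    {S : ℝ} {h : ℕ → ℝ} {y : ℕ → ℕ → Y} {z : ℝ → Y} {y' : ℕ → ℕ → Z} {z' : ℝ → Z}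
    (H : Tracks l S h y z) (H' : Tracks l S h y' z') :
    Tracks l S h (fun ν k => (y ν k, y' ν k)) fun s => (z s, z' s) := by
  intro ε hε
  obtain ⟨δ, hδ, h1⟩ := H ε hε
  obtain ⟨δ', hδ', h2⟩ := H' ε hε
  refine ⟨min δ δ', lt_min hδ hδ', fun s hs t ht hst hlt => ?_⟩
  filter_upwards [h1 s hs t ht hst (hlt.trans_le (min_le_left _ _)),
    h2 s hs t ht hst (hlt.trans_le (min_le_right _ _))] with ν hν hν' k hk1 hk2
  exact max_lt (hν k hk1 hk2) (hν' k hk1 hk2)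

theorem Tracks.pi {n : ℕ} {Y : Type*} [PseudoMetricSpace Y] {l : Filter ℕ}
    {S : ℝ} {h : ℕ → ℝ} {y : ℕ → ℕ → Fin n → Y} {z : Fin n → ℝ → Y}
    (H : ∀ i, Tracks l S h (fun ν k => y ν k i) (z i)) :
    Tracks l S h y fun s i => z i s := by
  intro ε hε
  choose δ hδ h1 using fun i => H i ε hε
  obtain ⟨δ₀, hδ₀, hle⟩ : ∃ δ₀ > 0, ∀ i, δ₀ ≤ δ i := by
    rcases isEmpty_or_nonempty (Fin n) with hn | hn
    · exact ⟨1, one_pos, fun i => hn.elim i⟩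
    · obtain ⟨i, hi⟩ := Finite.exists_min δ
      exact ⟨δ i, hδ i, hi⟩
  refine ⟨δ₀, hδ₀, fun s hs t ht hst hlt => ?_⟩
  filter_upwards [eventually_all.2 fun i => h1 i s hs t ht hst (hlt.trans_le (hle i))]
    with ν hν k hk1 hk2
  exact (dist_pi_lt_iff hε).2 fun i => hν i k hk1 hk2

theorem tracks_time {l : Filter ℕ} {S : ℝ} {h : ℕ → ℝ} (hh : ∀ ν, 0 < h ν)
    (h0 : Tendsto h l (𝓝 0)) : Tracks l S h (fun ν k => k * h ν) fun s => s := by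
  intro ε hε
  refine ⟨ε, hε, fun s hs t ht hst hlt => ?_⟩
  filter_upwards [(tendsto_stepIndex_mul hh h0 hs).eventually (lt_mem_nhds (sub_lt_self s hε))]
    with ν hν k hk1 hk2
  have h1 : (stepIndex S (h ν) s : ℝ) * h ν ≤ k * h ν :=
    mul_le_mul_of_nonneg_right (by exact_mod_cast hk1) (hh ν).le
  have h2 : (k : ℝ) * h ν ≤ stepIndex S (h ν) t * h ν :=
    mul_le_mul_of_nonneg_right (by exact_mod_cast hk2.le) (hh ν).le
  have h3 := stepIndex_mul_le_max (S := S) (hh ν) t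
  rw [min_eq_left ht.2, max_eq_right ht.1] at h3
  rw [Real.dist_eq, abs_lt]
  constructor <;> linarith

/-! ### Passage to the limit in the scheme. -/

section Limit

variable {E : Type*} [NormedAddCommGroup E] [InnerProductSpace ℝ E]

/-- A motion `x` with velocity `v`, subject to a force `g` and to impulses along `-n (x t)`
whose accumulated strength is `R`. -/
structure IsImpactMotion (Ω : Set E) (φ : E → ℝ) (n : E → E) (S C : ℝ) (g x v : ℝ → E)
    (R : ℝ → ℝ) : Prop where
  mono : Monotone R
  C_nonneg : 0 ≤ C
  norm_velocity_le : ∀ t ∈ Icc 0 S, ‖v t‖ ≤ C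
  norm_position_sub_le : ∀ s ∈ Icc 0 S, ∀ t ∈ Icc 0 S, s ≤ t → ‖x t - x s‖ ≤ C * (t - s)
  norm_velocity_sub_le : ∀ s ∈ Icc 0 S, ∀ t ∈ Icc 0 S, s ≤ t →
    ‖v t - v s‖ ≤ C * (t - s) + (R t - R s)
  abs_energy_sub_le : ∀ s ∈ Icc 0 S, ∀ t ∈ Icc 0 S, s ≤ t →
    |‖v t‖ ^ 2 - ‖v s‖ ^ 2| ≤ C * (t - s)
  norm_taylor_le : ∀ s ∈ Icc 0 S, ∀ t ∈ Icc 0 S, s ≤ t →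
    ‖x t - x s - (t - s) • v s‖ ≤ (t - s) * (C * (t - s) + (R t - R s))
  balance : ∀ ε > 0, ∃ δ > 0, ∀ s ∈ Icc 0 S, ∀ t ∈ Icc 0 S, s ≤ t → t - s < δ →
    ‖v t - v s - (t - s) • g s + (R t - R s) • n (x s)‖ ≤ ε * ((t - s) + (R t - R s))
  eventually_eq : ∀ t ∈ Icc 0 S, x t ∈ Ω → ∀ᶠ u in 𝓝 t, R u = R t
  definingFunction_nonpos : ∀ t ∈ Icc 0 S, φ (x t) ≤ 0

variable {Ω : Set E} {φ : E → ℝ} {N n : E → E} {r L B c M V S : ℝ} {h : ℕ → ℝ}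
  {f x v : ℕ → ℕ → E} {l : Filter ℕ}

theorem tracks_position (hS : 0 ≤ S)
    (H : ∀ᶠ ν in l, IsBoundedScheme Ω φ N r L B c M V S (h ν) (f ν) (x ν) (v ν))
    (hh : ∀ ν, 0 < h ν) (h0 : Tendsto h l (𝓝 0)) {X : ℝ → E}
    (hX : ∀ t, Tendsto (fun ν => x ν (stepIndex S (h ν) t)) l (𝓝 (X t))) :
    Tracks l S h x X := by
  intro ε hε
  have hV : 0 < |V| + 1 := by positivity
  -- The indices between those of `s` and `t` span time at most `(t - s) + h`, less than twice this
  -- `δ`, so the motion costs at most `2ε/3`; the remaining third is the convergence at `s`.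
  refine ⟨ε / (|V| + 1) / 3, by positivity, fun s hs t ht hst hlt => ?_⟩
  have hη : 0 < ε / (|V| + 1) / 3 := by positivity
  filter_upwards [H, h0.eventually (gt_mem_nhds hη),
    (hX s).eventually (Metric.ball_mem_nhds _ (show 0 < ε / 3 by positivity))] with
    ν hν h1 h2 k hk1 hk2
  have h3 := hν.norm_position_sub_le hk1
    (hν.of_le hk2.le (stepIndex_mul_le hS (hh ν) t))
  have h4 := stepIndex_sub_le (S := S) (hh ν) hst
  have h5 : (k : ℝ) * h ν ≤ stepIndex S (h ν) t * h ν :=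
    mul_le_mul_of_nonneg_right (by exact_mod_cast hk2.le) (hh ν).le
  have h6 : V * (k * h ν - stepIndex S (h ν) s * h ν) ≤
      (|V| + 1) * (ε / (|V| + 1) / 3 + ε / (|V| + 1) / 3) :=
    mul_le_mul (by linarith [le_abs_self V]) (by linarith)
      (sub_nonneg.2 (mul_le_mul_of_nonneg_right (by exact_mod_cast hk1) (hh ν).le)) hV.le
  have h7 : (|V| + 1) * (ε / (|V| + 1) / 3 + ε / (|V| + 1) / 3) = 2 * ε / 3 := by
    field_simp
    ring
  calc dist (x ν k) (X s) ≤ dist (x ν k) (x ν (stepIndex S (h ν) s)) +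
        dist (x ν (stepIndex S (h ν) s)) (X s) := dist_triangle _ _ _
    _ < 2 * ε / 3 + ε / 3 := by
        rw [dist_eq_norm (x ν k)]
        exact add_lt_add_of_le_of_lt (h3.trans (h6.trans h7.le)) h2
    _ = ε := by ring

/-- The discrete estimates are non-strict inequalities between convergent quantities. The constant
is a sum so that one `C` dominates the speed, force and energy constants; the two `Tracks`
hypotheses justify freezing force and normal in the balance. -/
theorem isImpactMotion_of_tendsto [l.NeBot] (hS : 0 ≤ S) (hM : 0 ≤ M) (hV : 0 ≤ V)
    (hΩ : IsOpen Ω) (hφ : Continuous φ)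
    (hn : ∀ y, c ≤ ‖N y‖ → n y = ‖N y‖⁻¹ • N y)
    (H : ∀ᶠ ν in l, IsBoundedScheme Ω φ N r L B c M V S (h ν) (f ν) (x ν) (v ν))
    (hh : ∀ ν, 0 < h ν) (h0 : Tendsto h l (𝓝 0)) {g X W : ℝ → E} {R : ℝ → ℝ}
    (hX : ∀ t, Tendsto (fun ν => x ν (stepIndex S (h ν) t)) l (𝓝 (X t)))
    (hW : ∀ t, Tendsto (fun ν => v ν (stepIndex S (h ν) t)) l (𝓝 (W t)))
    (hR : ∀ t, Tendsto
      (fun ν => totalImpulse Ω N (h ν) (f ν) (x ν) (v ν) (stepIndex S (h ν) t)) l (𝓝 (R t)))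
    (hg : Tracks l S h f g) (hb : Tracks l S h (fun ν k => n (x ν k)) fun s => n (X s)) :
    IsImpactMotion Ω φ n S (V + M + (2 * V * M + M ^ 2)) g X W R := by
  have hC0 : 0 ≤ 2 * V * M + M ^ 2 := by positivity
  have hle : ∀ ν t, (stepIndex S (h ν) t : ℝ) * h ν ≤ S := fun ν t => stepIndex_mul_le hS (hh ν) t
  have hlim := fun {t : ℝ} (ht : t ∈ Icc 0 S) => tendsto_stepIndex_mul hh h0 ht
  have hmono : Monotone R := fun s t hst =>
    le_of_tendsto_of_tendsto' (hR s) (hR t) fun ν =>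
      totalImpulse_mono _ _ _ _ _ _ (stepIndex_mono (hh ν) hst)
  refine ⟨hmono, by positivity, ?_, ?_, ?_, ?_, ?_, ?_, ?_, ?_⟩
  · intro t _
    refine le_of_tendsto (hW t).norm ?_
    filter_upwards [H] with ν hν
    have := hν.norm_velocity_le (hle ν t)
    linarith
  · intro s hs t ht hst
    refine (le_of_tendsto_of_tendsto ((hX t).sub (hX s)).norm
      (((hlim ht).sub (hlim hs)).const_mul V) ?_).trans ?_
    · filter_upwards [H] with ν hν
      exact hν.norm_position_sub_le (stepIndex_mono (hh ν) hst) (hle ν t)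
    · nlinarith
  · intro s hs t ht hst
    refine (le_of_tendsto_of_tendsto ((hW t).sub (hW s)).norm
      ((((hlim ht).sub (hlim hs)).const_mul M).add ((hR t).sub (hR s))) ?_).trans ?_
    · filter_upwards [H] with ν hν
      exact hν.norm_velocity_sub_le (stepIndex_mono (hh ν) hst) (hle ν t)
    · nlinarith
  · intro s hs t ht hst
    refine (le_of_tendsto_of_tendsto (((hW t).norm.pow 2).sub ((hW s).norm.pow 2)).abs
      (((hlim ht).sub (hlim hs)).const_mul (2 * V * M + M ^ 2)) ?_).trans ?_
    · filter_upwards [H] with ν hν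
      exact hν.abs_energy_sub_le (stepIndex_mono (hh ν) hst) (hle ν t)
    · nlinarith
  · intro s hs t ht hst
    have h1 := (hlim ht).sub (hlim hs)
    refine (le_of_tendsto_of_tendsto (((hX t).sub (hX s)).sub (h1.smul (hW s))).norm
      (h1.mul ((h1.const_mul M).add ((hR t).sub (hR s)))) ?_).trans ?_
    · filter_upwards [H] with ν hν
      exact hν.norm_position_taylor_le (stepIndex_mono (hh ν) hst) (hle ν t)
    · refine mul_le_mul_of_nonneg_left ?_ (sub_nonneg.2 hst)
      nlinarith
  · intro ε hε
    obtain ⟨δ, hδ, h1⟩ := hg ε hε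
    obtain ⟨δ', hδ', h2⟩ := hb ε hε
    refine ⟨min δ δ', lt_min hδ hδ', fun s hs t ht hst hlt => ?_⟩
    have h3 := (hlim ht).sub (hlim hs)
    have h4 := (hR t).sub (hR s)
    refine le_of_tendsto_of_tendsto ((((hW t).sub (hW s)).sub (h3.smul_const (g s))).add
      (h4.smul_const (n (X s)))).norm ((h3.add h4).const_mul ε) ?_
    filter_upwards [H, h1 s hs t ht hst (hlt.trans_le (min_le_left _ _)),
      h2 s hs t ht hst (hlt.trans_le (min_le_right _ _))] with ν hν hf hnx
    exact hν.norm_velocity_sub_add_le hn (stepIndex_mono (hh ν) hst) (hle ν t)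
      (fun k hk1 hk2 => by simpa [dist_eq_norm] using (hf k hk1 hk2).le)
      (fun k hk1 hk2 => by simpa [dist_eq_norm] using (hnx k hk1 hk2).le)
  · intro t _ hXt
    obtain ⟨d, hd, hball⟩ := Metric.isOpen_iff.1 hΩ _ hXt
    have hV1 : 0 < V + 1 := by positivity
    have hη : 0 < d / (V + 1) / 4 := by positivity
    -- Once `h < d / (V + 1) / 4`, the steps between `s` and `u` lie within time `d / (V + 1) / 2`
    -- of the step of `t`. Their positions are then within `d / 2` of the position at that step,
    -- itself within `d / 2` of `X t`. All lie in `Ω` and receive no impulse.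
    have key : ∀ s u, s ≤ u → s ≤ t → t ≤ u → u - s ≤ d / (V + 1) / 4 → R u = R s := by
      intro s u hsu hst htu hus
      refine tendsto_nhds_unique_of_eventuallyEq (hR u) (hR s) ?_
      filter_upwards [H, h0.eventually (gt_mem_nhds hη),
        (hX t).eventually (Metric.ball_mem_nhds _ (half_pos hd))] with ν hν h1 h2
      refine totalImpulse_eq_of_forall_mem (stepIndex_mono (hh ν) hsu) fun k hk1 hk2 => hball ?_
      have h4 := stepIndex_sub_le (S := S) (hh ν) hsu
      have hs' : (stepIndex S (h ν) s : ℝ) * h ν ≤ k * h ν :=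
        mul_le_mul_of_nonneg_right (by exact_mod_cast hk1) (hh ν).le
      have hu' : (k : ℝ) * h ν ≤ stepIndex S (h ν) u * h ν :=
        mul_le_mul_of_nonneg_right (by exact_mod_cast hk2.le) (hh ν).le
      have hs'' : (stepIndex S (h ν) s : ℝ) * h ν ≤ stepIndex S (h ν) t * h ν :=
        mul_le_mul_of_nonneg_right (by exact_mod_cast stepIndex_mono (hh ν) hst) (hh ν).le
      have hu'' : (stepIndex S (h ν) t : ℝ) * h ν ≤ stepIndex S (h ν) u * h ν :=
        mul_le_mul_of_nonneg_right (by exact_mod_cast stepIndex_mono (hh ν) htu) (hh ν).le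
      have h5 : dist (x ν k) (x ν (stepIndex S (h ν) t)) ≤
          V * (d / (V + 1) / 4 + d / (V + 1) / 4) := by
        rw [dist_eq_norm]
        rcases le_total (stepIndex S (h ν) t) k with htk | htk
        · refine (hν.norm_position_sub_le htk (hν.of_le hk2.le (hle ν u))).trans
            (mul_le_mul_of_nonneg_left ?_ hV)
          linarith
        · rw [norm_sub_rev]
          refine (hν.norm_position_sub_le htk (hle ν t)).trans
            (mul_le_mul_of_nonneg_left ?_ hV)
          linarith
      have h6 : V * (d / (V + 1) / 4 + d / (V + 1) / 4) ≤ d / 2 := by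
        have : (V + 1) * (d / (V + 1) / 4 + d / (V + 1) / 4) = d / 2 := by
          field_simp
          ring
        rw [← this]
        exact mul_le_mul_of_nonneg_right (by linarith) (by positivity)
      rw [Metric.mem_ball]
      have h7 : dist (x ν (stepIndex S (h ν) t)) (X t) < d / 2 := h2
      linarith [dist_triangle (x ν k) (x ν (stepIndex S (h ν) t)) (X t)]
    filter_upwards [Metric.ball_mem_nhds t hη] with u hu
    rw [Metric.mem_ball, Real.dist_eq, abs_lt] at hu
    rcases le_total t u with htu | htu
    · exact key t u htu le_rfl htu (by linarith)
    · exact (key u t htu htu le_rfl (by linarith)).symm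
  · intro t _
    have h1 : Tendsto (fun ν => (B * V + L * V ^ 2 + L * V ^ 2 * S) * h ν) l (𝓝 0) := by
      simpa using h0.const_mul (B * V + L * V ^ 2 + L * V ^ 2 * S)
    refine le_of_tendsto_of_tendsto ((hφ.tendsto _).comp (hX t)) h1 ?_
    filter_upwards [H] with ν hν
    exact hν.definingFunction_le (hle ν t)

theorem exists_bounceScheme {m : ℕ} (Ω : Set E) (N : E → E) (h : ℝ)
    (F : Fin m → ℝ → (Fin m → E) → E) (x₀ v₀ : Fin m → E) :
    ∃ x v : ℕ → Fin m → E, x 0 = x₀ ∧ v 0 = v₀ ∧ ∀ i,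
      IsBounceScheme Ω N h (fun k => F i (k * h) (x k)) (fun k => x k i) fun k => v k i := by
  let step : ℕ → (Fin m → E) × (Fin m → E) → (Fin m → E) × (Fin m → E) := fun k s =>
    (fun i => s.1 i + h • bounce Ω N (s.1 i) (s.2 i + h • F i (k * h) s.1),
      fun i => bounce Ω N (s.1 i) (s.2 i + h • F i (k * h) s.1))
  let s : ℕ → (Fin m → E) × (Fin m → E) := fun k => Nat.rec (x₀, v₀) step k
  exact ⟨fun k => (s k).1, fun k => (s k).2, rfl, rfl, fun i => ⟨fun k => rfl, fun k => rfl⟩⟩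

theorem exists_tendsto_of_eventually_mem {Y : Type*} [TopologicalSpace Y] (l : Ultrafilter ℕ)
    {K : Set Y} (hK : IsCompact K) {u : ℕ → Y} (hu : ∀ᶠ ν in (l : Filter ℕ), u ν ∈ K) :
    ∃ y ∈ K, Tendsto u l (𝓝 y) := by
  obtain ⟨y, hy, hle⟩ := hK.ultrafilter_le_nhds' (l.map u) hu
  exact ⟨y, hy, hle⟩

/-- Impact motions of `m` interacting particles exist. -/
theorem exists_isImpactMotion [FiniteDimensional ℝ E] {m : ℕ} (hS : 0 ≤ S) (hM : 0 ≤ M)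
    (hV : 0 ≤ V) (hΩ : IsOpen Ω) (hφ : Continuous φ) (hD : DefiningBounds Ω φ N r L B c)
    (hnc : Continuous n) (hn : ∀ y, c ≤ ‖N y‖ → n y = ‖N y‖⁻¹ • N y)
    {F : Fin m → ℝ → (Fin m → E) → E}
    (hF : ∀ i, Continuous fun q : ℝ × (Fin m → E) => F i q.1 q.2)
    (hFM : ∀ i t X, ‖F i t X‖ ≤ M) {x₀ v₀ : Fin m → E} (hx₀ : ∀ i, x₀ i ∈ Ω)
    (hspeed : ∀ i, ‖v₀ i‖ + M * S ≤ V) (hradius : ∀ i, ‖x₀ i‖ + V * S ≤ r) :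
    ∃ (C : ℝ) (x v : Fin m → ℝ → E) (R : Fin m → ℝ → ℝ), ∀ i, x i 0 = x₀ i ∧ v i 0 = v₀ i ∧
      IsImpactMotion Ω φ n S C (fun t => F i t fun j => x j t) (x i) (v i) (R i) := by
  -- Along an ultrafilter every sequence eventually in a compact set converges, so limits exist
  -- simultaneously for all times and particles, with no extraction of subsequences.
  let l : Ultrafilter ℕ := Filter.hyperfilter ℕ
  have hl : (l : Filter ℕ) ≤ atTop := Nat.hyperfilter_le_atTop
  let h : ℕ → ℝ := fun ν => 1 / ((ν : ℝ) + 1)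
  have hh : ∀ ν, 0 < h ν := fun ν => Nat.one_div_pos_of_nat
  have h0 : Tendsto h l (𝓝 0) := tendsto_one_div_add_atTop_nhds_zero_nat.mono_left hl
  have hh1 : ∀ ν, h ν ≤ 1 := fun ν => by
    refine (div_le_one (by positivity)).2 ?_
    have : (0 : ℝ) ≤ ν := Nat.cast_nonneg ν
    linarith
  choose X W hX0 hW0 hs using fun ν => exists_bounceScheme Ω N (h ν) F x₀ v₀
  have hsmall : ∀ᶠ ν in (l : Filter ℕ), (B * V + L * V ^ 2 + L * V ^ 2 * S) * h ν ≤ c := by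
    have h1 : Tendsto (fun ν => (B * V + L * V ^ 2 + L * V ^ 2 * S) * h ν) l (𝓝 0) := by
      simpa using h0.const_mul (B * V + L * V ^ 2 + L * V ^ 2 * S)
    exact (h1.eventually (gt_mem_nhds hD.c_pos)).mono fun _ h => le_of_lt h
  have H : ∀ i, ∀ᶠ ν in (l : Filter ℕ), IsBoundedScheme Ω φ N r L B c M V S (h ν)
      (fun k => F i (k * h ν) (X ν k)) (fun k => X ν k i) fun k => W ν k i := fun i => by
    filter_upwards [hsmall] with ν hν
    exact ⟨hs ν i, hD, hh ν, hh1 ν, hS, hM, hV, fun k => hFM _ _ _, by simpa [hX0] using hx₀ i,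
      by simpa [hW0] using hspeed i, by simpa [hX0] using hradius i, hν⟩
  have hle : ∀ ν t, (stepIndex S (h ν) t : ℝ) * h ν ≤ S := fun ν t => stepIndex_mul_le hS (hh ν) t
  have : ProperSpace E := FiniteDimensional.proper ℝ E
  have hxlim : ∀ i t, ∃ y ∈ Metric.closedBall (0 : E) r,
      Tendsto (fun ν => X ν (stepIndex S (h ν) t) i) l (𝓝 y) := fun i t =>
    exists_tendsto_of_eventually_mem l (isCompact_closedBall _ _)
      ((H i).mono fun ν hν => by simpa using hν.norm_position_le (hle ν t))
  have hvlim : ∀ i t, ∃ y ∈ Metric.closedBall (0 : E) V,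
      Tendsto (fun ν => W ν (stepIndex S (h ν) t) i) l (𝓝 y) := fun i t =>
    exists_tendsto_of_eventually_mem l (isCompact_closedBall _ _)
      ((H i).mono fun ν hν => by simpa using hν.norm_velocity_le (hle ν t))
  have hRlim : ∀ i t, ∃ y ∈ Icc 0 ((2 * (B * V) + (L * V ^ 2 + B * M) * S) / c),
      Tendsto (fun ν => totalImpulse Ω N (h ν) (fun k => F i (k * h ν) (X ν k))
        (fun k => X ν k i) (fun k => W ν k i) (stepIndex S (h ν) t)) l (𝓝 y) := fun i t =>
    exists_tendsto_of_eventually_mem l isCompact_Icc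
      ((H i).mono fun ν hν => ⟨Finset.sum_nonneg fun j _ => impulse_nonneg _ _ _ _,
        hν.totalImpulse_le (hle ν t)⟩)
  choose x hxr hx using hxlim
  choose v hvr hv using hvlim
  choose R hRr hR using hRlim
  have htr : ∀ i, Tracks l S h (fun ν k => X ν k i) (x i) := fun i =>
    tracks_position hS (H i) hh h0 (hx i)
  have hK : IsCompact (Icc 0 S ×ˢ Set.pi univ fun _ : Fin m => Metric.closedBall (0 : E) r) :=
    isCompact_Icc.prod (isCompact_univ_pi fun _ => isCompact_closedBall _ _)
  refine ⟨_, x, v, R, fun i => ⟨?_, ?_, isImpactMotion_of_tendsto hS hM hV hΩ hφ hn (H i) hh h0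
    (hx i) (hv i) (hR i) ?_ ?_⟩⟩
  · refine tendsto_nhds_unique (hx i 0) ?_
    simp [stepIndex_zero hS, hX0]
  · refine tendsto_nhds_unique (hv i 0) ?_
    simp [stepIndex_zero hS, hW0]
  · exact ((tracks_time hh h0).prodMk (Tracks.pi htr)).comp hK
      (fun s hs => ⟨hs, fun j _ => hxr j s⟩) (hF i)
  · exact (htr i).comp (isCompact_closedBall (0 : E) r) (fun s _ => hxr i s) hnc

end Limit

/-! ### One-sided limits of the velocity -/

section OneSided

variable {E : Type*} [NormedAddCommGroup E] [InnerProductSpace ℝ E]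

/-- The oscillation of `v` is dominated by that of the convergent `Q`, so `v` is Cauchy along `l`.
-/
theorem exists_tendsto_of_norm_sub_le {G : Type*} [NormedAddCommGroup G] [CompleteSpace G]
    {l : Filter ℝ} [l.NeBot] {v : ℝ → G} {Q : ℝ → ℝ} {q : ℝ} {A : Set ℝ} (hA : A ∈ l) (hQ : Tendsto Q l (𝓝 q))
    (h : ∀ s ∈ A, ∀ t ∈ A, s ≤ t → ‖v t - v s‖ ≤ Q t - Q s) : ∃ w, Tendsto v l (𝓝 w) := by
  refine cauchy_map_iff_exists_tendsto.1 (cauchy_map_iff'.2 ?_)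
  have h1 : Tendsto (fun p : ℝ × ℝ => (Q p.1, Q p.2)) (l ×ˢ l) (uniformity ℝ) :=
    cauchy_map_iff'.1 hQ.cauchy_map
  rw [tendsto_uniformity_iff_dist_tendsto_zero] at h1 ⊢
  refine squeeze_zero' (Eventually.of_forall fun _ => dist_nonneg) ?_ h1
  filter_upwards [prod_mem_prod hA hA] with p hp
  rcases le_total p.1 p.2 with hle | hle
  · rw [dist_comm, dist_eq_norm, dist_comm, Real.dist_eq]
    exact (h _ hp.1 _ hp.2 hle).trans (le_abs_self _)
  · rw [dist_eq_norm, Real.dist_eq]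
    exact (h _ hp.2 _ hp.1 hle).trans (le_abs_self _)

theorem hasDerivWithinAt_of_norm_sub_le {A : Set ℝ} {t : ℝ} {x : ℝ → E} {w : E} {e : ℝ → ℝ}
    (h : ∀ᶠ u in 𝓝[A] t, ‖x u - x t - (u - t) • w‖ ≤ |u - t| * e u)
    (he : Tendsto e (𝓝[A] t) (𝓝 0)) : HasDerivWithinAt x w A t := by
  rw [hasDerivWithinAt_iff_isLittleO, Asymptotics.isLittleO_iff]
  intro ε hε
  filter_upwards [h, he.eventually (gt_mem_nhds hε)] with u h1 h2
  rw [Real.norm_eq_abs, mul_comm]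
  exact h1.trans (mul_le_mul_of_nonneg_left h2.le (abs_nonneg _))

/-- The right derivative of a trajectory. -/
noncomputable def rightVelocity (x : ℝ → E) (t : ℝ) : E := derivWithin x (Ioi t) t

namespace IsImpactMotion

variable {Ω : Set E} {φ : E → ℝ} {n : E → E} {S C : ℝ} {g x v : ℝ → E} {R : ℝ → ℝ}

theorem tendsto_add_rightLim (H : IsImpactMotion Ω φ n S C g x v R) (t : ℝ) :
    Tendsto (fun u => C * u + R u) (𝓝[>] t) (𝓝 (C * t + Function.rightLim R t)) :=
  ((tendsto_id.const_mul C).mono_left nhdsWithin_le_nhds).add (H.mono.tendsto_rightLim t)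

theorem tendsto_add_leftLim (H : IsImpactMotion Ω φ n S C g x v R) (t : ℝ) :
    Tendsto (fun u => C * u + R u) (𝓝[<] t) (𝓝 (C * t + Function.leftLim R t)) :=
  ((tendsto_id.const_mul C).mono_left nhdsWithin_le_nhds).add (H.mono.tendsto_leftLim t)

theorem continuousOn_position (H : IsImpactMotion Ω φ n S C g x v R) :
    ContinuousOn x (Icc 0 S) := by
  have h : LipschitzOnWith ⟨C, H.C_nonneg⟩ x (Icc 0 S) := by
    refine LipschitzOnWith.of_dist_le_mul fun s hs t ht => ?_
    rcases le_total s t with hst | hst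
    · rw [dist_comm, dist_eq_norm, dist_comm, Real.dist_eq, abs_of_nonneg (sub_nonneg.2 hst)]
      exact H.norm_position_sub_le s hs t ht hst
    · rw [dist_eq_norm, Real.dist_eq, abs_of_nonneg (sub_nonneg.2 hst)]
      exact H.norm_position_sub_le t ht s hs hst
  exact h.continuousOn

theorem tendsto_right_of_continuousOn {Y : Type*} [TopologicalSpace Y] {y : ℝ → Y} {t : ℝ}
    (hy : ContinuousOn y (Icc 0 S)) (ht : t ∈ Ico 0 S) : Tendsto y (𝓝[>] t) (𝓝 (y t)) :=
  (hy t ⟨ht.1, ht.2.le⟩).tendsto.mono_left (nhdsWithin_le_of_mem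
    (mem_of_superset (Ioo_mem_nhdsGT ht.2) fun _ hu => ⟨ht.1.trans hu.1.le, hu.2.le⟩))

theorem tendsto_left_of_continuousOn {Y : Type*} [TopologicalSpace Y] {y : ℝ → Y} {t : ℝ}
    (hy : ContinuousOn y (Icc 0 S)) (ht : t ∈ Ioc 0 S) : Tendsto y (𝓝[<] t) (𝓝 (y t)) :=
  (hy t ⟨ht.1.le, ht.2⟩).tendsto.mono_left (nhdsWithin_le_of_mem
    (mem_of_superset (Ioo_mem_nhdsLT ht.1) fun _ hu => ⟨hu.1.le, hu.2.le.trans ht.2⟩))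

variable [CompleteSpace E]

theorem exists_right (H : IsImpactMotion Ω φ n S C g x v R) {t : ℝ} (ht : t ∈ Ico 0 S) :
    ∃ w, Tendsto v (𝓝[>] t) (𝓝 w) ∧ HasDerivWithinAt x w (Ioi t) t := by
  have hmem : Ioo t S ∈ 𝓝[>] t := Ioo_mem_nhdsGT ht.2
  have hsub : ∀ u ∈ Ioo t S, u ∈ Icc 0 S := fun u hu => ⟨ht.1.trans hu.1.le, hu.2.le⟩
  obtain ⟨w, hw⟩ := exists_tendsto_of_norm_sub_le (v := v) hmem (H.tendsto_add_rightLim t)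
    fun s hs u hu hsu => by
      have := H.norm_velocity_sub_le s (hsub s hs) u (hsub u hu) hsu
      linarith
  refine ⟨w, hw, hasDerivWithinAt_of_norm_sub_le
    (e := fun u => (C * u + R u) - (C * t + Function.rightLim R t)) ?_ ?_⟩
  · filter_upwards [hmem] with u hu
    have hx := tendsto_right_of_continuousOn H.continuousOn_position ht
    have hid : Tendsto (fun s : ℝ => s) (𝓝[>] t) (𝓝 t) := tendsto_id.mono_left nhdsWithin_le_nhds
    rw [abs_of_pos (sub_pos.2 hu.1)]
    -- The base point `s` of the Taylor estimate tends to `t` from the right. Taking `s = t`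
    -- directly would leave the jump `R(t+) - R(t)` in the error.
    refine le_of_tendsto_of_tendsto
      ((tendsto_const_nhds.sub hx).sub ((tendsto_const_nhds.sub hid).smul hw)).norm
      ((tendsto_const_nhds.sub hid).mul
        (tendsto_const_nhds.sub (H.tendsto_add_rightLim t))) ?_
    filter_upwards [Ioo_mem_nhdsGT hu.1] with s hs
    refine (H.norm_taylor_le s (hsub s ⟨hs.1, hs.2.trans hu.2⟩) u (hsub u hu) hs.2.le).trans
      (le_of_eq ?_)
    ring
  · simpa using (H.tendsto_add_rightLim t).sub_const (C * t + Function.rightLim R t)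

theorem exists_left (H : IsImpactMotion Ω φ n S C g x v R) {t : ℝ} (ht : t ∈ Ioc 0 S) :
    ∃ w, Tendsto v (𝓝[<] t) (𝓝 w) ∧ HasDerivWithinAt x w (Iio t) t := by
  have hmem : Ioo 0 t ∈ 𝓝[<] t := Ioo_mem_nhdsLT ht.1
  have hsub : ∀ u ∈ Ioo 0 t, u ∈ Icc 0 S := fun u hu => ⟨hu.1.le, hu.2.le.trans ht.2⟩
  obtain ⟨w, hw⟩ := exists_tendsto_of_norm_sub_le (v := v) hmem (H.tendsto_add_leftLim t)
    fun s hs u hu hsu => by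
      have := H.norm_velocity_sub_le s (hsub s hs) u (hsub u hu) hsu
      linarith
  refine ⟨w, hw, hasDerivWithinAt_of_norm_sub_le
    (e := fun s => ((C * t + Function.leftLim R t) - (C * s + R s)) + ‖v s - w‖) ?_ ?_⟩
  · filter_upwards [hmem] with s hs
    have hx := tendsto_left_of_continuousOn H.continuousOn_position ht
    have hid : Tendsto (fun s : ℝ => s) (𝓝[<] t) (𝓝 t) := tendsto_id.mono_left nhdsWithin_le_nhds
    have h1 : ‖x t - x s - (t - s) • v s‖ ≤
        (t - s) * ((C * t + Function.leftLim R t) - (C * s + R s)) := by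
      refine le_of_tendsto_of_tendsto
        ((hx.sub tendsto_const_nhds).sub ((hid.sub tendsto_const_nhds).smul
          tendsto_const_nhds)).norm
        ((hid.sub tendsto_const_nhds).mul ((H.tendsto_add_leftLim t).sub tendsto_const_nhds)) ?_
      filter_upwards [Ioo_mem_nhdsLT hs.2] with u hu
      refine (H.norm_taylor_le s (hsub s hs) u (hsub u ⟨hs.1.trans hu.1, hu.2⟩) hu.1.le).trans
        (le_of_eq ?_)
      ring
    have h2 : x s - x t - (s - t) • w =
        -(x t - x s - (t - s) • v s) - (t - s) • (v s - w) := by module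
    rw [abs_of_neg (sub_neg.2 hs.2), neg_sub, h2, mul_add]
    refine (norm_sub_le _ _).trans ?_
    rw [norm_neg, norm_smul, Real.norm_eq_abs, abs_of_pos (sub_pos.2 hs.2)]
    linarith
  · simpa using ((H.tendsto_add_leftLim t).const_sub (C * t + Function.leftLim R t)).add
      (hw.sub_const w).norm

theorem hasDerivWithinAt_right (H : IsImpactMotion Ω φ n S C g x v R) {t : ℝ}
    (ht : t ∈ Ico 0 S) : HasDerivWithinAt x (rightVelocity x t) (Ioi t) t := by
  obtain ⟨w, -, hw⟩ := H.exists_right ht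
  rwa [rightVelocity, hw.derivWithin (uniqueDiffWithinAt_Ioi t)]

theorem tendsto_right (H : IsImpactMotion Ω φ n S C g x v R) {t : ℝ} (ht : t ∈ Ico 0 S) :
    Tendsto v (𝓝[>] t) (𝓝 (rightVelocity x t)) := by
  obtain ⟨w, h, hw⟩ := H.exists_right ht
  rwa [rightVelocity, hw.derivWithin (uniqueDiffWithinAt_Ioi t)]

theorem norm_rightVelocity_le (H : IsImpactMotion Ω φ n S C g x v R) {t : ℝ}
    (ht : t ∈ Ico 0 S) : ‖rightVelocity x t‖ ≤ C := by
  refine le_of_tendsto (H.tendsto_right ht).norm ?_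
  filter_upwards [Ioo_mem_nhdsGT ht.2] with u hu
  exact H.norm_velocity_le u ⟨ht.1.trans hu.1.le, hu.2.le⟩

theorem _root_.tendsto_const_add_nhdsGT (s : ℝ) :
    Tendsto (fun η : ℝ => s + η) (𝓝[>] 0) (𝓝[>] s) := by
  refine tendsto_nhdsWithin_iff.2 ⟨?_, ?_⟩
  · have : Tendsto (fun η : ℝ => s + η) (𝓝 0) (𝓝 (s + 0)) := tendsto_const_nhds.add tendsto_id
    rw [add_zero] at this
    exact this.mono_left nhdsWithin_le_nhds
  · filter_upwards [self_mem_nhdsWithin] with η hη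
    exact lt_add_of_pos_right s hη

/-- Both end points are shifted right by the same `η`, which keeps the elapsed time. Right limits
are used because the value of `v` at a jump time need not be a one-sided limit. -/
theorem norm_rightVelocity_sub_le (H : IsImpactMotion Ω φ n S C g x v R) {s t : ℝ} (hs : 0 ≤ s)
    (hst : s ≤ t) (ht : t < S) : ‖rightVelocity x t - rightVelocity x s‖ ≤
      C * (t - s) + (Function.rightLim R t - Function.rightLim R s) := by
  have h1 := tendsto_const_add_nhdsGT s
  have h2 := tendsto_const_add_nhdsGT t
  have hs' : s ∈ Ico 0 S := ⟨hs, hst.trans_lt ht⟩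
  have ht' : t ∈ Ico 0 S := ⟨hs.trans hst, ht⟩
  refine le_of_tendsto_of_tendsto (((H.tendsto_right ht').comp h2).sub
    ((H.tendsto_right hs').comp h1)).norm (tendsto_const_nhds.add
      (((H.mono.tendsto_rightLim t).comp h2).sub ((H.mono.tendsto_rightLim s).comp h1))) ?_
  filter_upwards [Ioo_mem_nhdsGT (sub_pos.2 ht)] with η hη
  have := H.norm_velocity_sub_le (s + η) ⟨by linarith [hη.1], by linarith [hη.2]⟩ (t + η)
    ⟨by linarith [hη.1], by linarith [hη.2]⟩ (by linarith)
  simpa using this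

theorem tendsto_rightVelocity_right (H : IsImpactMotion Ω φ n S C g x v R) {t : ℝ}
    (ht : t ∈ Ico 0 S) : Tendsto (rightVelocity x) (𝓝[>] t) (𝓝 (rightVelocity x t)) := by
  rw [tendsto_iff_norm_sub_tendsto_zero]
  have h1 : Tendsto (Function.rightLim R) (𝓝[>] t) (𝓝 (Function.rightLim R t)) :=
    (H.mono.stieltjesFunction.right_continuous t).tendsto.mono_left
      (nhdsWithin_mono _ Ioi_subset_Ici_self)
  have h2 : Tendsto (fun u => C * (u - t) + (Function.rightLim R u - Function.rightLim R t))
      (𝓝[>] t) (𝓝 0) := by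
    have h3 : Tendsto (fun u : ℝ => u) (𝓝[>] t) (𝓝 t) := tendsto_id.mono_left nhdsWithin_le_nhds
    simpa using ((h3.sub_const t).const_mul C).add (h1.sub_const (Function.rightLim R t))
  refine squeeze_zero' (Eventually.of_forall fun _ => norm_nonneg _) ?_ h2
  filter_upwards [Ioo_mem_nhdsGT ht.2] with u hu
  exact H.norm_rightVelocity_sub_le ht.1 hu.1.le hu.2

theorem tendsto_rightVelocity_left (H : IsImpactMotion Ω φ n S C g x v R) {t : ℝ}
    (ht : t ∈ Ioc 0 S) {w : E} (hw : Tendsto v (𝓝[<] t) (𝓝 w)) :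
    Tendsto (rightVelocity x) (𝓝[<] t) (𝓝 w) := by
  rw [Metric.tendsto_nhds] at hw ⊢
  intro ε hε
  have h1 := hw (ε / 2) (half_pos hε)
  obtain ⟨a, hat, ha⟩ := (mem_nhdsLT_iff_exists_Ioo_subset' ht.1).1 h1
  filter_upwards [Ioo_mem_nhdsLT ht.1, Ioo_mem_nhdsLT hat] with u hu hu'
  have h2 : dist (rightVelocity x u) w ≤ ε / 2 := by
    refine le_of_tendsto ((H.tendsto_right ⟨hu.1.le, hu.2.trans_le ht.2⟩).dist
      tendsto_const_nhds) ?_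
    filter_upwards [Ioo_mem_nhdsGT hu'.2] with z hz
    exact (ha ⟨hu'.1.trans hz.1, hz.2⟩ : dist (v z) w < ε / 2).le
  linarith

/-- The momentum balance for the right-continuous velocity. -/
theorem rightVelocity_balance (H : IsImpactMotion Ω φ n S C g x v R) (hg : ContinuousOn g (Icc 0 S))
    (hn : Continuous n) {ε : ℝ} (hε : 0 < ε) : ∃ δ > 0, ∀ s t, 0 ≤ s → s ≤ t → t < S →
      t - s < δ → ‖rightVelocity x t - rightVelocity x s - (t - s) • g s +
        (Function.rightLim R t - Function.rightLim R s) • n (x s)‖ ≤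
          ε * ((t - s) + (Function.rightLim R t - Function.rightLim R s)) := by
  obtain ⟨δ, hδ, h⟩ := H.balance ε hε
  refine ⟨δ, hδ, fun s t hs hst ht hlt => ?_⟩
  have h1 := tendsto_const_add_nhdsGT s
  have h2 := tendsto_const_add_nhdsGT t
  have hs' : s ∈ Ico 0 S := ⟨hs, hst.trans_lt ht⟩
  have ht' : t ∈ Ico 0 S := ⟨hs.trans hst, ht⟩
  have hgs := (tendsto_right_of_continuousOn hg hs').comp h1
  have hns := (tendsto_right_of_continuousOn
    (hn.comp_continuousOn H.continuousOn_position) hs').comp h1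
  have hRt := ((H.mono.tendsto_rightLim t).comp h2).sub ((H.mono.tendsto_rightLim s).comp h1)
  refine le_of_tendsto_of_tendsto (((((H.tendsto_right ht').comp h2).sub
    ((H.tendsto_right hs').comp h1)).sub (hgs.const_smul (t - s))).add (hRt.smul hns)).norm
      ((tendsto_const_nhds.add hRt).const_mul ε) ?_
  filter_upwards [Ioo_mem_nhdsGT (sub_pos.2 ht)] with η hη
  have := h (s + η) ⟨by linarith [hη.1], by linarith [hη.2]⟩ (t + η)
    ⟨by linarith [hη.1], by linarith [hη.2]⟩ (by linarith) (by linarith)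
  simpa using this

/-- Over the shrinking interval `[t - η, t + η]` the force contribution vanishes, and the balance
leaves an error `ε J` for every `ε > 0`. The energy bound has no impulse term, so it tends to zero
and the two speeds agree. -/
theorem jump (H : IsImpactMotion Ω φ n S C g x v R) (hg : ContinuousOn g (Icc 0 S))
    (hn : Continuous n) {t : ℝ} (ht : t ∈ Ioo 0 S) {w : E} (hw : Tendsto v (𝓝[<] t) (𝓝 w)) :
    rightVelocity x t = w - (Function.rightLim R t - Function.leftLim R t) • n (x t) ∧
      ‖rightVelocity x t‖ = ‖w‖ := by
  have h1 := tendsto_const_add_nhdsGT t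
  have h2 : Tendsto (fun η : ℝ => t - η) (𝓝[>] 0) (𝓝[<] t) := by
    refine tendsto_nhdsWithin_iff.2 ⟨?_, ?_⟩
    · have : Tendsto (fun η : ℝ => t - η) (𝓝 0) (𝓝 (t - 0)) := tendsto_const_nhds.sub tendsto_id
      rw [sub_zero] at this
      exact this.mono_left nhdsWithin_le_nhds
    · filter_upwards [self_mem_nhdsWithin] with η hη
      exact sub_lt_self t hη
  have h3 : Tendsto (fun η : ℝ => (t + η) - (t - η)) (𝓝[>] 0) (𝓝 0) := by
    have := ((h1.mono_right nhdsWithin_le_nhds).sub (h2.mono_right nhdsWithin_le_nhds))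
    simpa using this
  have hv1 := (H.tendsto_right ⟨ht.1.le, ht.2⟩).comp h1
  have hv2 := hw.comp h2
  have hR := ((H.mono.tendsto_rightLim t).comp h1).sub ((H.mono.tendsto_leftLim t).comp h2)
  have hmem : ∀ᶠ η in 𝓝[>] (0 : ℝ), t - η ∈ Icc 0 S ∧ t + η ∈ Icc 0 S ∧ t - η ≤ t + η := by
    filter_upwards [Ioo_mem_nhdsGT (lt_min ht.1 (sub_pos.2 ht.2))] with η hη
    have h4 := hη.2.trans_le (min_le_left _ _)
    have h5 := hη.2.trans_le (min_le_right _ _)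
    have h6 := hη.1
    exact ⟨⟨by linarith, by linarith⟩, ⟨by linarith, by linarith⟩, by linarith⟩
  constructor
  · set J := Function.rightLim R t - Function.leftLim R t with hJ
    have hgs := (tendsto_left_of_continuousOn hg ⟨ht.1, ht.2.le⟩).comp h2
    have hns := (tendsto_left_of_continuousOn
      (hn.comp_continuousOn H.continuousOn_position) ⟨ht.1, ht.2.le⟩).comp h2
    have key : ∀ ε > 0, ‖rightVelocity x t - w - (0 : ℝ) • g t + J • n (x t)‖ ≤
        ε * (0 + J) := by
      intro ε hε
      obtain ⟨δ, hδ, h⟩ := H.balance ε hε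
      refine le_of_tendsto_of_tendsto (((hv1.sub hv2).sub (h3.smul hgs)).add
        (hR.smul hns)).norm ((h3.add hR).const_mul ε) ?_
      filter_upwards [hmem, h3.eventually (gt_mem_nhds hδ)] with η hη hlt
      exact h _ hη.1 _ hη.2.1 hη.2.2 hlt
    have hlim : Tendsto (fun ε : ℝ => ε * (0 + J)) (𝓝[>] 0) (𝓝 (0 * (0 + J))) :=
      (tendsto_id.mono_left nhdsWithin_le_nhds).mul_const _
    have h0 := ge_of_tendsto hlim (by
      filter_upwards [self_mem_nhdsWithin] with ε hε
      exact key ε hε)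
    rw [zero_mul, norm_le_zero_iff, zero_smul, sub_zero] at h0
    rw [eq_sub_iff_add_eq, ← sub_eq_zero, ← h0]
    abel
  · have h4 : |‖rightVelocity x t‖ ^ 2 - ‖w‖ ^ 2| ≤ C * 0 := by
      refine le_of_tendsto_of_tendsto ((hv1.norm.pow 2).sub (hv2.norm.pow 2)).abs
        (h3.const_mul C) ?_
      filter_upwards [hmem] with η hη
      exact H.abs_energy_sub_le _ hη.1 _ hη.2.1 hη.2.2
    rw [mul_zero] at h4
    have h5 := abs_nonpos_iff.1 h4
    exact (pow_left_inj₀ (norm_nonneg _) (norm_nonneg _) two_ne_zero).1 (sub_eq_zero.1 h5)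

end IsImpactMotion

end OneSided

/-! ### The weak form of the equation of motion -/

/-- A function that varies less than any multiple of `Q` at small scales is constant. -/
theorem eq_of_locally_abs_sub_le {Z Q : ℝ → ℝ} {a b : ℝ} (hab : a ≤ b)
    (h : ∀ ε > 0, ∃ δ > 0, ∀ s t, a ≤ s → s ≤ t → t ≤ b → t - s < δ →
      |Z t - Z s| ≤ ε * (Q t - Q s)) : Z b = Z a := by
  -- On an equal partition of mesh below `δ` the increments of `Q` telescope, so no power of the
  -- mesh is needed; then `ε` tends to zero.
  have key : ∀ ε > 0, |Z b - Z a| ≤ ε * (Q b - Q a) := by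
    intro ε hε
    obtain ⟨δ, hδ, h1⟩ := h ε hε
    obtain ⟨m, hm⟩ := exists_nat_gt ((b - a) / δ)
    have hm0 : (0 : ℝ) < m := (div_nonneg (sub_nonneg.2 hab) hδ.le).trans_lt hm
    have hstep : (b - a) / m < δ := by
      rw [div_lt_iff₀ hδ] at hm
      rw [div_lt_iff₀ hm0]
      linarith
    have hs0 : 0 ≤ (b - a) / m := div_nonneg (sub_nonneg.2 hab) hm0.le
    have hind : ∀ k : ℕ, k ≤ m → |Z (a + k * ((b - a) / m)) - Z a| ≤
        ε * (Q (a + k * ((b - a) / m)) - Q a) := by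
      intro k
      induction k with
      | zero => simp
      | succ k ih =>
        intro hk
        have h2 := ih (by omega)
        have h3 : ((k + 1 : ℕ) : ℝ) * ((b - a) / m) ≤ m * ((b - a) / m) :=
          mul_le_mul_of_nonneg_right (by exact_mod_cast hk) hs0
        rw [mul_div_cancel₀ _ hm0.ne'] at h3
        have h4 : 0 ≤ (k : ℝ) * ((b - a) / m) := by positivity
        have h5 : ((k + 1 : ℕ) : ℝ) * ((b - a) / m) = k * ((b - a) / m) + (b - a) / m := by
          push_cast
          ring
        have h6 := h1 (a + k * ((b - a) / m)) (a + (k + 1 : ℕ) * ((b - a) / m)) (by linarith)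
          (by linarith) (by linarith) (by linarith)
        have h7 := abs_sub_le (Z (a + (k + 1 : ℕ) * ((b - a) / m))) (Z (a + k * ((b - a) / m)))
          (Z a)
        linarith
    have h8 := hind m le_rfl
    rwa [mul_div_cancel₀ _ hm0.ne', add_sub_cancel] at h8
  have hlim : Tendsto (fun ε : ℝ => ε * (Q b - Q a)) (𝓝[>] 0) (𝓝 (0 * (Q b - Q a))) :=
    (tendsto_id.mono_left nhdsWithin_le_nhds).mul_const _
  have h0 := ge_of_tendsto hlim (by
    filter_upwards [self_mem_nhdsWithin] with ε hε
    exact key ε hε)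
  rw [zero_mul] at h0
  exact sub_eq_zero.1 (abs_nonpos_iff.1 h0)

section WeakForm

variable {E : Type*} [NormedAddCommGroup E] [InnerProductSpace ℝ E] [CompleteSpace E]

namespace IsImpactMotion

variable {Ω : Set E} {φ : E → ℝ} {n : E → E} {S C T : ℝ} {g x v : ℝ → E} {R : ℝ → ℝ}

theorem integrableOn_inner_rightVelocity (H : IsImpactMotion Ω φ n S C g x v R) (hTS : T < S)
    {χ : ℝ → E} (hχ : Continuous χ) :
    IntegrableOn (fun t => inner ℝ (rightVelocity x t) (χ t)) (Icc 0 T) := by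
  obtain ⟨K, hK⟩ := (isCompact_Icc (a := 0) (b := T)).exists_bound_of_continuousOn hχ.continuousOn
  refine Measure.integrableOn_of_bounded (M := C * K) (by simp)
    ((aestronglyMeasurable_derivWithin_Ioi x _).inner hχ.aestronglyMeasurable) ?_
  filter_upwards [ae_restrict_mem measurableSet_Icc] with t ht
  exact (norm_inner_le_norm _ _).trans (mul_le_mul
    (H.norm_rightVelocity_le ⟨ht.1, ht.2.trans_lt hTS⟩) (hK t ht) (norm_nonneg _) H.C_nonneg)

theorem weak_form (H : IsImpactMotion Ω φ n S C g x v R) (hT : 0 < T) (hTS : T < S)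
    (hg : ContinuousOn g (Icc 0 S)) (hn : Continuous n) {ψ : ℝ → E} (hψ : ContDiff ℝ 1 ψ)
    (h0 : ψ 0 = 0) (h1 : ψ T = 0) :
    -∫ t in 0..T, inner ℝ (rightVelocity x t) (deriv ψ t) =
      (∫ t in 0..T, inner ℝ (g t) (ψ t)) -
        ∫ t in Ioc 0 T, inner ℝ (n (x t)) (ψ t) ∂H.mono.stieltjesFunction.measure := by
  set μ := H.mono.stieltjesFunction.measure with hμ
  set f := Function.rightLim R with hf
  have hfm : Monotone f := H.mono.rightLim
  have hψc := hψ.continuous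
  have hψ'c : Continuous (deriv ψ) := hψ.continuous_deriv le_rfl
  have hsub : Icc 0 T ⊆ Icc 0 S := Icc_subset_Icc_right hTS.le
  have hgψ : ContinuousOn (fun t => inner ℝ (g t) (ψ t)) (Icc 0 T) :=
    (hg.mono hsub).inner hψc.continuousOn
  have hnψ : ContinuousOn (fun t => inner ℝ (n (x t)) (ψ t)) (Icc 0 T) :=
    ((hn.comp_continuousOn H.continuousOn_position).mono hsub).inner hψc.continuousOn
  have hi1 := H.integrableOn_inner_rightVelocity hTS hψ'c
  have hi2 : IntegrableOn (fun t => inner ℝ (g t) (ψ t)) (Icc 0 T) :=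
    hgψ.integrableOn_compact isCompact_Icc
  have hi3 : IntegrableOn (fun t => inner ℝ (n (x t)) (ψ t)) (Icc 0 T) μ :=
    hnψ.integrableOn_compact isCompact_Icc
  have hii : ∀ {u : ℝ → ℝ}, IntegrableOn u (Icc 0 T) → ∀ s t, 0 ≤ s → s ≤ t → t ≤ T →
      IntervalIntegrable u volume s t := fun hu s t hs hst ht =>
    (intervalIntegrable_iff_integrableOn_Ioc_of_le hst).2
      (hu.mono_set fun z hz => ⟨hs.trans hz.1.le, hz.2.trans ht⟩)
  obtain ⟨A, hA⟩ := (isCompact_Icc (a := 0) (b := T)).exists_bound_of_continuousOn hψc.continuousOn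
  obtain ⟨K, hK⟩ := (isCompact_Icc (a := 0) (b := T)).exists_bound_of_continuousOn
    hψ'c.continuousOn
  have hA0 : 0 ≤ A := (norm_nonneg _).trans (hA 0 ⟨le_rfl, hT.le⟩)
  have hK0 : 0 ≤ K := (norm_nonneg _).trans (hK 0 ⟨le_rfl, hT.le⟩)
  have hC0 := H.C_nonneg
  have hloc : ∀ {u : ℝ → ℝ}, ContinuousOn u (Icc 0 T) → ∀ ε > 0, ∃ δ > 0, ∀ s ∈ Icc 0 T,
      ∀ t ∈ Icc 0 T, s ≤ t → t - s < δ → |u t - u s| ≤ ε := by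
    intro u hu ε hε
    obtain ⟨δ, hδ, h⟩ := Metric.uniformContinuousOn_iff.1
      (isCompact_Icc.uniformContinuousOn_of_continuous hu) ε hε
    refine ⟨δ, hδ, fun s hs t ht hst hlt => ?_⟩
    have := h t ht s hs (by rwa [Real.dist_eq, abs_of_nonneg (sub_nonneg.2 hst)])
    rw [Real.dist_eq] at this
    exact this.le
  -- The defect in integration by parts up to time `t`. It is shown to be constant by comparing its
  -- increments with those of `t + f t`.
  let Z : ℝ → ℝ := fun t => inner ℝ (rightVelocity x t) (ψ t) -
    (∫ τ in 0..t, inner ℝ (rightVelocity x τ) (deriv ψ τ)) -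
    (∫ τ in 0..t, inner ℝ (g τ) (ψ τ)) + ∫ τ in Ioc 0 t, inner ℝ (n (x τ)) (ψ τ) ∂μ
  have hZ : Z T = Z 0 := by
    refine eq_of_locally_abs_sub_le (Q := fun t => t + f t) hT.le fun ε' hε' => ?_
    -- `A` bounds `ψ` in the tested momentum balance, `K * (C + 1)` handles the velocity variation
    -- against `deriv ψ`, and `2` covers freezing the force and reaction integrands.
    obtain ⟨ε, hε, hεle⟩ : ∃ ε > 0, ε * (A + K * (C + 1) + 2) ≤ ε' :=
      ⟨ε' / (A + K * (C + 1) + 2), by positivity, (div_mul_cancel₀ _ (by positivity)).le⟩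
    obtain ⟨δ₁, hδ₁, hb⟩ := H.rightVelocity_balance hg hn hε
    obtain ⟨δ₂, hδ₂, hb2⟩ := hloc hgψ ε hε
    obtain ⟨δ₃, hδ₃, hb3⟩ := hloc hnψ ε hε
    -- The bound `t - s < ε` makes the product of velocity variation and elapsed time in `J1` small.
    refine ⟨min (min δ₁ δ₂) (min δ₃ ε), by positivity, fun s t hs hst ht hlt => ?_⟩
    have hd := lt_min_iff.1 hlt
    have hd1 := lt_min_iff.1 hd.1
    have hd2 := lt_min_iff.1 hd.2
    have hsT : s ∈ Icc 0 T := ⟨hs, hst.trans ht⟩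
    have htT : t ∈ Icc 0 T := ⟨hs.trans hst, ht⟩
    have hts0 : 0 ≤ t - s := sub_nonneg.2 hst
    have hfst : 0 ≤ f t - f s := sub_nonneg.2 (hfm hst)
    have e1 := hb s t hs hst (ht.trans_lt hTS) hd1.1
    have I1 := intervalIntegral.integral_add_adjacent_intervals
      (hii hi1 0 s le_rfl hs hsT.2) (hii hi1 s t hs hst ht)
    have I2 := intervalIntegral.integral_add_adjacent_intervals
      (hii hi2 0 s le_rfl hs hsT.2) (hii hi2 s t hs hst ht)
    have I3 : ∫ τ in Ioc 0 t, inner ℝ (n (x τ)) (ψ τ) ∂μ =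
        (∫ τ in Ioc 0 s, inner ℝ (n (x τ)) (ψ τ) ∂μ) +
          ∫ τ in Ioc s t, inner ℝ (n (x τ)) (ψ τ) ∂μ := by
      rw [← Ioc_union_Ioc_eq_Ioc hs hst]
      exact setIntegral_union (Ioc_disjoint_Ioc_of_le le_rfl) measurableSet_Ioc
        (hi3.mono_set fun z hz => ⟨hz.1.le, hz.2.trans hsT.2⟩)
        (hi3.mono_set fun z hz => ⟨hs.trans hz.1.le, hz.2.trans ht⟩)
    have J1 : |inner ℝ (rightVelocity x t) (ψ t - ψ s) -
        ∫ τ in s..t, inner ℝ (rightVelocity x τ) (deriv ψ τ)| ≤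
          K * (C * (t - s) + (f t - f s)) * (t - s) := by
      have hψst : ψ t - ψ s = ∫ τ in s..t, deriv ψ τ :=
        (intervalIntegral.integral_deriv_eq_sub (fun z _ => hψ.differentiable one_ne_zero z)
          (hψ'c.intervalIntegrable _ _)).symm
      have hin : inner ℝ (rightVelocity x t) (ψ t - ψ s) =
          ∫ τ in s..t, inner ℝ (rightVelocity x t) (deriv ψ τ) := by
        rw [hψst]
        exact ((innerSL ℝ (rightVelocity x t)).intervalIntegral_comp_comm
          (hψ'c.intervalIntegrable _ _)).symm
      rw [hin, ← intervalIntegral.integral_sub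
        ((continuous_const.inner hψ'c).intervalIntegrable _ _) (hii hi1 s t hs hst ht)]
      have := intervalIntegral.norm_integral_le_of_norm_le_const (a := s) (b := t)
        (f := fun τ => inner ℝ (rightVelocity x t) (deriv ψ τ) -
          inner ℝ (rightVelocity x τ) (deriv ψ τ))
        (C := K * (C * (t - s) + (f t - f s))) fun τ hτ => by
          rw [uIoc_of_le hst] at hτ
          rw [← inner_sub_left, mul_comm K]
          refine (norm_inner_le_norm _ _).trans (mul_le_mul ?_
            (hK τ ⟨hs.trans hτ.1.le, hτ.2.trans ht⟩) (norm_nonneg _) (by positivity))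
          refine (H.norm_rightVelocity_sub_le (hs.trans hτ.1.le) hτ.2
            (ht.trans_lt hTS)).trans ?_
          have := hfm hτ.1.le
          have := mul_le_mul_of_nonneg_left (sub_le_sub_left hτ.1.le t) hC0
          linarith
      rwa [Real.norm_eq_abs, abs_of_nonneg hts0] at this
    have J2 : |(∫ τ in s..t, inner ℝ (g τ) (ψ τ)) - (t - s) * inner ℝ (g s) (ψ s)| ≤
        ε * (t - s) := by
      have hc : (t - s) * inner ℝ (g s) (ψ s) = ∫ τ in s..t, (inner ℝ (g s) (ψ s) : ℝ) := by
        simp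
      rw [hc, ← intervalIntegral.integral_sub (hii hi2 s t hs hst ht)
        intervalIntegrable_const]
      have := intervalIntegral.norm_integral_le_of_norm_le_const (a := s) (b := t)
        (f := fun τ => inner ℝ (g τ) (ψ τ) - inner ℝ (g s) (ψ s)) (C := ε) fun τ hτ => by
          rw [uIoc_of_le hst] at hτ
          exact hb2 s hsT τ ⟨hs.trans hτ.1.le, hτ.2.trans ht⟩ hτ.1.le (by linarith [hτ.2])
      rwa [Real.norm_eq_abs, abs_of_nonneg hts0] at this
    have hμst : μ.real (Ioc s t) = f t - f s := by
      rw [Measure.real, hμ, StieltjesFunction.measure_Ioc, ENNReal.toReal_ofReal]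
      · rfl
      · exact hfst
    have hμfin : μ (Ioc s t) < ⊤ := by
      rw [hμ, StieltjesFunction.measure_Ioc]
      exact ENNReal.ofReal_lt_top
    have J3 : |(∫ τ in Ioc s t, inner ℝ (n (x τ)) (ψ τ) ∂μ) -
        (f t - f s) * inner ℝ (n (x s)) (ψ s)| ≤ ε * (f t - f s) := by
      have hc : (f t - f s) * inner ℝ (n (x s)) (ψ s) =
          ∫ τ in Ioc s t, (inner ℝ (n (x s)) (ψ s) : ℝ) ∂μ := by
        rw [setIntegral_const, hμst, smul_eq_mul]
      rw [hc, ← integral_sub (hi3.mono_set fun z hz => ⟨hs.trans hz.1.le, hz.2.trans ht⟩)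
        (integrableOn_const hμfin.ne), ← hμst]
      exact norm_setIntegral_le_of_norm_le_const (C := ε)
        (f := fun τ => inner ℝ (n (x τ)) (ψ τ) - inner ℝ (n (x s)) (ψ s)) hμfin fun τ hτ =>
          hb3 s hsT τ ⟨hs.trans hτ.1.le, hτ.2.trans ht⟩ hτ.1.le (by linarith [hτ.2])
    have J0 : |inner ℝ (rightVelocity x t - rightVelocity x s - (t - s) • g s +
        (f t - f s) • n (x s)) (ψ s)| ≤ ε * ((t - s) + (f t - f s)) * A :=
      (abs_real_inner_le_norm _ _).trans (mul_le_mul e1 (hA s hsT) (norm_nonneg _) (by positivity))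
    have hsplit : Z t - Z s =
        inner ℝ (rightVelocity x t - rightVelocity x s - (t - s) • g s +
          (f t - f s) • n (x s)) (ψ s) +
        (inner ℝ (rightVelocity x t) (ψ t - ψ s) -
          ∫ τ in s..t, inner ℝ (rightVelocity x τ) (deriv ψ τ)) -
        ((∫ τ in s..t, inner ℝ (g τ) (ψ τ)) - (t - s) * inner ℝ (g s) (ψ s)) +
        ((∫ τ in Ioc s t, inner ℝ (n (x τ)) (ψ τ) ∂μ) -
          (f t - f s) * inner ℝ (n (x s)) (ψ s)) := by
      simp only [Z]
      rw [I3, ← I1, ← I2, inner_add_left, inner_sub_left, inner_sub_left, inner_sub_right,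
        real_inner_smul_left, real_inner_smul_left]
      ring
    have hJ1' : K * (C * (t - s) + (f t - f s)) * (t - s) ≤
        ε * (K * (C + 1)) * ((t - s) + (f t - f s)) := by
      have h2 : C * (t - s) + (f t - f s) ≤ (C + 1) * ((t - s) + (f t - f s)) := by nlinarith
      calc K * (C * (t - s) + (f t - f s)) * (t - s) ≤
          K * ((C + 1) * ((t - s) + (f t - f s))) * ε := by
            refine mul_le_mul (mul_le_mul_of_nonneg_left h2 hK0) hd2.2.le hts0 (by positivity)
        _ = _ := by ring
    have hfin : |Z t - Z s| ≤ ε * (A + K * (C + 1) + 2) * ((t - s) + (f t - f s)) := by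
      rw [hsplit]
      refine (abs_add_le _ _).trans ?_
      refine (add_le_add_left ((abs_sub _ _).trans (add_le_add_left (abs_add_le _ _) _)) _).trans ?_
      nlinarith
    refine hfin.trans ((mul_le_mul_of_nonneg_right hεle (by positivity)).trans (le_of_eq ?_))
    ring
  simp only [Z, h0, h1, inner_zero_right, intervalIntegral.integral_same, Ioc_self,
    Measure.restrict_empty, integral_zero_measure] at hZ
  linarith

end IsImpactMotion

end WeakForm

/-! ### Solutions of the reflected particle problem -/

theorem IsTestFunction.eq_zero {m : ℕ} {T : ℝ} {ψ : ℝ → EuclideanSpace ℝ (Fin m)}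
    (hψ : IsTestFunction T ψ) {t : ℝ} (ht : t ∉ Ioo 0 T) : ψ t = 0 :=
  image_eq_zero_of_notMem_tsupport fun h => ht (hψ.2.2 h)

theorem integral_Ioo_eq_intervalIntegral {T : ℝ} (hT : 0 ≤ T) (u : ℝ → ℝ) :
    ∫ t in Ioo 0 T, u t = ∫ t in 0..T, u t := by
  rw [intervalIntegral.integral_of_le hT, integral_Ioc_eq_integral_Ioo]

/-- The reflection of a velocity `w` at a wall with unit normal `e`. -/
theorem eq_reflection {E : Type*} [NormedAddCommGroup E] [InnerProductSpace ℝ E] {u w e : E}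
    {J : ℝ} (he : ‖e‖ = 1) (hJ : u = w - J • e) (hnorm : ‖u‖ = ‖w‖) (hu : inner ℝ e u ≤ 0)
    (hw : 0 ≤ inner ℝ e w) : u = w - (2 * inner ℝ w e) • e := by
  have h1 : ‖u‖ ^ 2 = ‖w‖ ^ 2 - 2 * (J * inner ℝ e w) + J ^ 2 := by
    rw [hJ, norm_sub_sq_real, inner_smul_right, norm_smul, he, real_inner_comm, mul_one,
      Real.norm_eq_abs, sq_abs]
  have h2 : J * (J - 2 * inner ℝ e w) = 0 := by
    rw [hnorm] at h1
    linarith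
  rw [real_inner_comm e w]
  rcases mul_eq_zero.1 h2 with h | h
  · rw [h, zero_smul, sub_zero] at hJ
    rw [hJ] at hu ⊢
    rw [le_antisymm hu hw]
    simp
  · rw [hJ, sub_eq_zero.1 h]

namespace IsImpactMotion

variable {m : ℕ} {Ω : Set (EuclideanSpace ℝ (Fin m))} {φ : EuclideanSpace ℝ (Fin m) → ℝ}
  {n : EuclideanSpace ℝ (Fin m) → EuclideanSpace ℝ (Fin m)} {S C T : ℝ}
  {g x v : ℝ → EuclideanSpace ℝ (Fin m)} {R : ℝ → ℝ}

/-- Along the trajectory `φ ≤ 0`, with equality at `t`. Hence the left derivative of `φ ∘ x` is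
nonnegative and the right one nonpositive, which gives the signs of the normal velocities. -/
theorem satisfiesReflectionRule (H : IsImpactMotion Ω φ n S C g x v R)
    (hg : ContinuousOn g (Icc 0 S)) (hn : Continuous n) (hφ : Differentiable ℝ φ)
    (hΩ : HasC3Boundary Ω)
    (hfr : ∀ q ∈ frontier Ω, φ q = 0 ∧ ∃ a : ℝ, 0 < a ∧ ∇ φ q = a • outwardNormal Ω q)
    (hnν : ∀ q ∈ frontier Ω, n q = outwardNormal Ω q) {t : ℝ} (ht : t ∈ Ioo 0 S)
    (hxt : x t ∈ frontier Ω) : SatisfiesReflectionRule Ω x t := by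
  obtain ⟨w, hw, hwd⟩ := H.exists_left ⟨ht.1, ht.2.le⟩
  have hud := H.hasDerivWithinAt_right ⟨ht.1.le, ht.2⟩
  obtain ⟨hjump, hnorm⟩ := H.jump hg hn ht hw
  obtain ⟨h0, a, ha, hgrad⟩ := hfr _ hxt
  have hcomp : ∀ {y : EuclideanSpace ℝ (Fin m)} {A : Set ℝ}, HasDerivWithinAt x y A t →
      HasDerivWithinAt (fun s => φ (x s)) (a * inner ℝ (outwardNormal Ω (x t)) y) A t := by
    intro y A hy
    have h1 := (hφ (x t)).hasGradientAt.hasFDerivAt.comp_hasDerivWithinAt t hy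
    rwa [InnerProductSpace.toDual_apply_apply, hgrad, real_inner_smul_left] at h1
  refine ⟨w, _, hwd, hud, eq_reflection (norm_outwardNormal hΩ hxt) (by rwa [hnν _ hxt] at hjump)
    hnorm ?_ ?_⟩
  · have h1 := (hasDerivWithinAt_iff_tendsto_slope' self_notMem_Ioi).1 (hcomp hud)
    have h2 := le_of_tendsto (b := (0 : ℝ)) h1 (by
      filter_upwards [Ioo_mem_nhdsGT ht.2] with s hs
      rw [slope_def_field, h0, sub_zero]
      exact div_nonpos_of_nonpos_of_nonneg
        (H.definingFunction_nonpos s ⟨ht.1.le.trans hs.1.le, hs.2.le⟩) (sub_nonneg.2 hs.1.le))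
    exact nonpos_of_mul_nonpos_right h2 ha
  · have h1 := (hasDerivWithinAt_iff_tendsto_slope' self_notMem_Iio).1 (hcomp hwd)
    have h2 := ge_of_tendsto (b := (0 : ℝ)) h1 (by
      filter_upwards [Ioo_mem_nhdsLT ht.1] with s hs
      rw [slope_def_field, h0, sub_zero]
      exact div_nonneg_of_nonpos
        (H.definingFunction_nonpos s ⟨hs.1.le, hs.2.le.trans ht.2.le⟩) (sub_nonpos.2 hs.2.le))
    exact nonneg_of_mul_nonneg_right h2 ha

theorem isW1InftyWithDeriv (H : IsImpactMotion Ω φ n S C g x v R) (hT : 0 < T) (hTS : T < S) :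
    IsW1InftyWithDeriv T x (rightVelocity x) := by
  have hsub : Icc 0 T ⊆ Icc 0 S := Icc_subset_Icc_right hTS.le
  have hxc : ContinuousOn x (Icc 0 T) := H.continuousOn_position.mono hsub
  refine ⟨?_, ?_, ?_, ?_⟩
  · obtain ⟨K, hK⟩ := isCompact_Icc.exists_bound_of_continuousOn hxc
    refine memLp_top_of_bound ((hxc.mono Ioo_subset_Icc_self).aestronglyMeasurable
      measurableSet_Ioo) K ?_
    filter_upwards [ae_restrict_mem measurableSet_Ioo] with t ht
    exact hK t (Ioo_subset_Icc_self ht)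
  · refine memLp_top_of_bound (aestronglyMeasurable_derivWithin_Ioi x _) C ?_
    filter_upwards [ae_restrict_mem measurableSet_Ioo] with t ht
    exact H.norm_rightVelocity_le ⟨ht.1.le, ht.2.trans hTS⟩
  · intro ψ hψ
    have hψd : Differentiable ℝ ψ := hψ.1.differentiable (by norm_num)
    have hψ'c : Continuous (deriv ψ) := hψ.1.continuous_deriv (by norm_num)
    have hi1 : IntervalIntegrable (fun t => inner ℝ (x t) (deriv ψ t)) volume 0 T :=
      (hxc.inner hψ'c.continuousOn).intervalIntegrable_of_Icc hT.le
    have hi2 : IntervalIntegrable (fun t => inner ℝ (rightVelocity x t) (ψ t)) volume 0 T :=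
      (intervalIntegrable_iff_integrableOn_Ioc_of_le hT.le).2
        ((H.integrableOn_inner_rightVelocity hTS hψd.continuous).mono_set Ioc_subset_Icc_self)
    have h1 := intervalIntegral.integral_eq_sub_of_hasDeriv_right_of_le hT.le
      (hxc.inner hψd.continuous.continuousOn)
      (fun t ht => (H.hasDerivWithinAt_right ⟨ht.1.le, ht.2.trans hTS⟩).inner ℝ
        (hψd t).hasDerivAt.hasDerivWithinAt) (hi1.add hi2)
    rw [intervalIntegral.integral_add hi1 hi2, hψ.eq_zero right_notMem_Ioo,
      hψ.eq_zero left_notMem_Ioo, inner_zero_right, inner_zero_right, sub_zero] at h1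
    rw [integral_Ioo_eq_intervalIntegral hT.le, integral_Ioo_eq_intervalIntegral hT.le]
    linarith
  · refine ⟨⟨C, H.C_nonneg⟩, LipschitzOnWith.of_dist_le_mul fun s hs t ht => ?_⟩
    rcases le_total s t with hst | hst
    · rw [dist_comm, dist_eq_norm, dist_comm, Real.dist_eq, abs_of_nonneg (sub_nonneg.2 hst)]
      exact H.norm_position_sub_le s (hsub hs) t (hsub ht) hst
    · rw [dist_eq_norm, Real.dist_eq, abs_of_nonneg (sub_nonneg.2 hst)]
      exact H.norm_position_sub_le t (hsub ht) s (hsub hs) hst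

/-- The reaction measure on `(0,T)` of an impact motion. -/
noncomputable def reaction (H : IsImpactMotion Ω φ n S C g x v R) (T : ℝ) : Measure ℝ :=
  H.mono.stieltjesFunction.measure.restrict (Ioo 0 T)

theorem isFiniteMeasure_reaction (H : IsImpactMotion Ω φ n S C g x v R) (T : ℝ) :
    IsFiniteMeasure (H.reaction T) := by
  refine ⟨?_⟩
  rw [reaction, Measure.restrict_apply_univ]
  refine (measure_mono Ioo_subset_Ioc_self).trans_lt ?_
  rw [StieltjesFunction.measure_Ioc]
  exact ENNReal.ofReal_lt_top

/-- Near a time with interior position `R` is constant, hence so are its right limits, and a small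
half-open interval has no Stieltjes mass. -/
theorem support_reaction_subset (H : IsImpactMotion Ω φ n S C g x v R) (hΩ : IsOpen Ω)
    (hTS : T < S) (hcl : ∀ t ∈ Icc 0 T, x t ∈ closure Ω) :
    (H.reaction T).support ⊆ contactTimes Ω T x := by
  intro t ht
  by_contra hct
  refine (Measure.notMem_support_iff_exists.2 ?_) ht
  by_cases htT : t ∈ Icc 0 T
  · have hxt : x t ∈ Ω := by
      by_contra h
      refine hct ⟨htT, ?_⟩
      rw [frontier, hΩ.interior_eq]
      exact ⟨hcl t htT, h⟩
    obtain ⟨a, b, hab, hR⟩ := mem_nhds_iff_exists_Ioo_subset.1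
      (H.eventually_eq t ⟨htT.1, htT.2.trans hTS.le⟩ hxt)
    have hlim : ∀ u ∈ Ioo a b, Function.rightLim R u = R t := fun u hu =>
      rightLim_eq_of_tendsto (tendsto_const_nhds.congr' (by
        filter_upwards [Ioo_mem_nhdsGT hu.2] with z hz
        exact (hR ⟨hu.1.trans hz.1, hz.2⟩ : R z = R t).symm))
    obtain ⟨a', ha, hat⟩ := exists_between hab.1
    obtain ⟨b', htb, hb⟩ := exists_between hab.2
    refine ⟨Ioc a' b', Ioc_mem_nhds hat htb, le_antisymm ((Measure.restrict_apply_le _ _).trans ?_)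
      zero_le⟩
    rw [StieltjesFunction.measure_Ioc, H.mono.stieltjesFunction_eq, H.mono.stieltjesFunction_eq,
      hlim b' ⟨hab.1.trans htb, hb⟩, hlim a' ⟨ha, hat.trans hab.2⟩, sub_self, ENNReal.ofReal_zero]
  · refine ⟨(Icc 0 T)ᶜ, isClosed_Icc.isOpen_compl.mem_nhds htT, ?_⟩
    rw [reaction, Measure.restrict_apply measurableSet_Icc.compl]
    rw [disjoint_iff_inter_eq_empty.1 (disjoint_compl_left.mono_right Ioo_subset_Icc_self),
      measure_empty]

theorem isClosed_contactTimes (H : IsImpactMotion Ω φ n S C g x v R) (hTS : T < S) :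
    IsClosed (contactTimes Ω T x) :=
  (H.continuousOn_position.mono (Icc_subset_Icc_right hTS.le)).preimage_isClosed_of_isClosed
    isClosed_Icc isClosed_frontier

/-- The restricted measure is carried by the contact times, and a possible atom at `T` is harmless
because `ψ` vanishes there. -/
theorem setIntegral_reaction (H : IsImpactMotion Ω φ n S C g x v R) (hΩ : IsOpen Ω)
    (hTS : T < S) (hcl : ∀ t ∈ Icc 0 T, x t ∈ closure Ω)
    (hnν : ∀ q ∈ frontier Ω, n q = outwardNormal Ω q) {ψ : ℝ → EuclideanSpace ℝ (Fin m)}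
    (hψ : IsTestFunction T ψ) :
    ∫ t in contactTimes Ω T x, inner ℝ (outwardNormal Ω (x t)) (ψ t) ∂H.reaction T =
      ∫ t in Ioc 0 T, inner ℝ (n (x t)) (ψ t) ∂H.mono.stieltjesFunction.measure := by
  have hA := (H.isClosed_contactTimes hTS).measurableSet (s := contactTimes Ω T x)
  have h0 : H.reaction T (contactTimes Ω T x)ᶜ = 0 :=
    measure_mono_null (compl_subset_compl.2 (H.support_reaction_subset hΩ hTS hcl))
      Measure.measure_compl_support
  rw [setIntegral_congr_fun (g := fun t => inner ℝ (n (x t)) (ψ t)) hA fun t ht => by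
    simp only [hnν _ ht.2]]
  rw [reaction, Measure.restrict_restrict hA]
  rw [reaction, Measure.restrict_apply hA.compl] at h0
  symm
  refine setIntegral_eq_of_subset_of_ae_sdiff_eq_zero measurableSet_Ioc.nullMeasurableSet
    (inter_subset_right.trans Ioo_subset_Ioc_self) ?_
  filter_upwards [measure_eq_zero_iff_ae_notMem.1 h0] with t ht1 ht2
  have : t ∉ Ioo 0 T := fun h => ht1 ⟨fun hc => ht2.2 ⟨hc, h⟩, h⟩
  rw [hψ.eq_zero this, inner_zero_right]

theorem isParticleSolution {k : ℕ} (hT : 0 < T) (hTS : T < S) (hΩ : IsOpen Ω)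
    (hC3 : HasC3Boundary Ω) (hφ : Differentiable ℝ φ) (hpos : ∀ y ∉ closure Ω, 0 < φ y)
    (hfr : ∀ q ∈ frontier Ω, φ q = 0 ∧ ∃ a : ℝ, 0 < a ∧ ∇ φ q = a • outwardNormal Ω q)
    (hnν : ∀ q ∈ frontier Ω, n q = outwardNormal Ω q) (hn : Continuous n)
    {F : Fin k → ℝ → (Fin k → EuclideanSpace ℝ (Fin m)) → EuclideanSpace ℝ (Fin m)}
    {x₀ v₀ : Fin k → EuclideanSpace ℝ (Fin m)} {X : Fin k → ℝ → EuclideanSpace ℝ (Fin m)}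
    {i : Fin k} (H : IsImpactMotion Ω φ n S C g (X i) v R) (hg : ContinuousOn g (Icc 0 S))
    (hgF : ∀ t ∈ Icc 0 T, F i t (fun j => X j t) = g t) (hX0 : X i 0 = x₀ i) (hv0 : v 0 = v₀ i)
    (hx₀ : x₀ i ∈ Ω) :
    IsParticleSolution Ω T F x₀ v₀ X i (rightVelocity (X i)) (H.reaction T) := by
  have hS : 0 < S := hT.trans hTS
  have hcl : ∀ t ∈ Icc 0 T, X i t ∈ closure Ω := fun t ht => by
    by_contra h
    exact absurd (hpos _ h) (not_lt.2 (H.definingFunction_nonpos t ⟨ht.1, ht.2.trans hTS.le⟩))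
  have hw := H.isW1InftyWithDeriv hT hTS
  have hfin := H.isFiniteMeasure_reaction T
  have hF : ∀ ψ : ℝ → EuclideanSpace ℝ (Fin m),
      ∫ t in Ioo 0 T, inner ℝ (F i t fun j => X j t) (ψ t) =
        ∫ t in Ioo 0 T, inner ℝ (g t) (ψ t) := fun ψ =>
    setIntegral_congr_fun measurableSet_Ioo fun t ht => by
      simp only [hgF t (Ioo_subset_Icc_self ht)]
  have hweak : ∀ ψ, IsTestFunction T ψ →
      -∫ t in Ioo 0 T, inner ℝ (rightVelocity (X i) t) (deriv ψ t) =
        (∫ t in Ioo 0 T, inner ℝ (F i t fun j => X j t) (ψ t)) -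
          ∫ t in contactTimes Ω T (X i), inner ℝ (outwardNormal Ω (X i t)) (ψ t)
            ∂H.reaction T := by
    intro ψ hψ
    rw [hF, H.setIntegral_reaction hΩ hTS hcl hnν hψ, integral_Ioo_eq_intervalIntegral hT.le,
      integral_Ioo_eq_intervalIntegral hT.le]
    exact H.weak_form hT hTS hg hn (hψ.1.of_le (by norm_num)) (hψ.eq_zero left_notMem_Ioo)
      (hψ.eq_zero right_notMem_Ioo)
  refine ⟨hw, hcl, ⟨hw.memLp_deriv.mono_exponent le_top, ?_, ?_, ?_⟩, hX0, ?_, hfin, ?_,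
    H.support_reaction_subset hΩ hTS hcl, hweak, ?_⟩
  -- The weak form itself bounds the variation: the force contributes at most `G` times the length,
  -- the reaction at most its mass, the normals being unit vectors.
  · obtain ⟨G, hG⟩ := isCompact_Icc.exists_bound_of_continuousOn hg
    refine ⟨G * volume.real (Ioo 0 T) + 1 * (H.reaction T).real (contactTimes Ω T (X i)),
      fun ψ hψ hψ1 => ?_⟩
    have h1 := hweak ψ hψ
    rw [hF] at h1
    have h2 : ‖∫ t in Ioo 0 T, inner ℝ (g t) (ψ t)‖ ≤ G * volume.real (Ioo 0 T) := by
      refine norm_setIntegral_le_of_norm_le_const (by simp) fun t ht => ?_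
      have hgt := hG t ⟨ht.1.le, ht.2.le.trans hTS.le⟩
      have := mul_le_mul hgt (hψ1 t) (norm_nonneg _) ((norm_nonneg _).trans hgt)
      rw [mul_one] at this
      exact (norm_inner_le_norm _ _).trans this
    have h3 : ‖∫ t in contactTimes Ω T (X i), inner ℝ (outwardNormal Ω (X i t)) (ψ t)
        ∂H.reaction T‖ ≤ 1 * (H.reaction T).real (contactTimes Ω T (X i)) := by
      refine norm_setIntegral_le_of_norm_le_const (measure_lt_top _ _) fun t ht => ?_
      refine (norm_inner_le_norm _ _).trans ?_
      rw [norm_outwardNormal hC3 ht.2, one_mul]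
      exact hψ1 t
    have h4 := (abs_le.1 h2).1
    have h5 := (abs_le.1 h3).2
    linarith
  · exact fun t ht => ⟨_, H.tendsto_rightVelocity_right ⟨ht.1, ht.2.trans hTS⟩⟩
  · intro t ht
    have ht' : t ∈ Ioc 0 S := ⟨ht.1, ht.2.trans hTS.le⟩
    obtain ⟨w, hw, -⟩ := H.exists_left ht'
    exact ⟨w, H.tendsto_rightVelocity_left ht' hw⟩
  · have h1 := H.hasDerivWithinAt_right (t := 0) ⟨le_rfl, hS⟩
    have h2 := H.tendsto_right (t := 0) ⟨le_rfl, hS⟩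
    -- The start lies in the open set `Ω`, so `R` is constant near `0` and the velocity changes
    -- there by at most `C t`.
    have h3 : Tendsto v (𝓝[>] 0) (𝓝 (v 0)) := by
      rw [tendsto_iff_norm_sub_tendsto_zero]
      have h4 : Tendsto (fun t : ℝ => C * t) (𝓝[>] 0) (𝓝 0) := by
        have : Tendsto (fun t : ℝ => C * t) (𝓝 0) (𝓝 (C * 0)) := tendsto_id.const_mul C
        rw [mul_zero] at this
        exact this.mono_left nhdsWithin_le_nhds
      refine squeeze_zero' (Eventually.of_forall fun _ => norm_nonneg _) ?_ h4
      filter_upwards [Ioo_mem_nhdsGT hS, nhdsWithin_le_nhds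
        (H.eventually_eq 0 ⟨le_rfl, hS.le⟩ (by rwa [hX0]))] with t ht hRt
      have h5 := H.norm_velocity_sub_le 0 ⟨le_rfl, hS.le⟩ t ⟨ht.1.le, ht.2.le⟩ ht.1.le
      rw [show R t = R 0 from hRt] at h5
      linarith
    rwa [tendsto_nhds_unique h2 h3, hv0] at h1
  · rw [reaction, Measure.restrict_apply measurableSet_Ioo.compl, compl_inter_self, measure_empty]
  · exact fun t ht hti => H.satisfiesReflectionRule hg hn hφ hC3 hfr hnν
      ⟨hti.1, hti.2.trans hTS⟩ ht.2

end IsImpactMotion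

/-- A continuous map on a compact set extends to a bounded continuous map. -/
theorem exists_bounded_extension {Y E : Type*} [TopologicalSpace Y] [NormalSpace Y] [T2Space Y]
    [NormedAddCommGroup E] [NormedSpace ℝ E] [FiniteDimensional ℝ E] {K : Set Y}
    (hK : IsCompact K) {f : Y → E} (hf : ContinuousOn f K) :
    ∃ (M : ℝ) (G : Y → E), 0 ≤ M ∧ Continuous G ∧ (∀ y, ‖G y‖ ≤ M) ∧ EqOn G f K := by
  obtain ⟨M, hM⟩ := hK.exists_bound_of_continuousOn hf
  have hM0 : 0 < max M 0 + 1 := by positivity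
  have := Metric.instTietzeExtensionClosedBall ℝ (0 : E) hM0
  have hmem : ∀ y : K, K.domRestrict f y ∈ Metric.closedBall (0 : E) (max M 0 + 1) := fun y => by
    rw [mem_closedBall_zero_iff]
    exact (hM y y.2).trans ((le_max_left M 0).trans (le_add_of_nonneg_right zero_le_one))
  obtain ⟨G, hG⟩ := ContinuousMap.exists_restrict_eq (Y := Metric.closedBall (0 : E) (max M 0 + 1))
    hK.isClosed ⟨fun y => ⟨K.domRestrict f y, hmem y⟩, hf.domRestrict.subtype_mk hmem⟩
  exact ⟨max M 0 + 1, fun y => (G y : E), hM0.le, continuous_subtype_val.comp G.continuous,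
    fun y => mem_closedBall_zero_iff.1 (G y).2, fun y hy =>
      congrArg Subtype.val (DFunLike.congr_fun hG ⟨y, hy⟩)⟩

theorem theorem2p1 (m n : ℕ) (Ω : Set (EuclideanSpace ℝ (Fin m)))
    (hΩ_open : IsOpen Ω) (hΩ_bounded : Bornology.IsBounded Ω) (hΩ_C3 : HasC3Boundary Ω)
    (T : ℝ) (hT : 0 < T)
    (F : Fin n → ℝ → (Fin n → EuclideanSpace ℝ (Fin m)) → EuclideanSpace ℝ (Fin m))
    (hF : ∀ i, ContinuousOn (fun q : ℝ × (Fin n → EuclideanSpace ℝ (Fin m)) => F i q.1 q.2)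
      (Icc 0 T ×ˢ {X | ∀ j, X j ∈ closure Ω}))
    (x₀ v₀ : Fin n → EuclideanSpace ℝ (Fin m)) (hx₀ : ∀ i, x₀ i ∈ Ω) :
    ∃ x : Fin n → ℝ → EuclideanSpace ℝ (Fin m), IsSolution Ω T F x₀ v₀ x := by
  have hK : IsCompact
      (Icc 0 T ×ˢ {X : Fin n → EuclideanSpace ℝ (Fin m) | ∀ j, X j ∈ closure Ω}) :=
    isCompact_Icc.prod (isCompact_pi_infinite fun _ => hΩ_bounded.isCompact_closure)
  choose M G hM0 hGc hGM hGF using fun i => exists_bounded_extension hK (hF i)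
  obtain ⟨φ, hφ, hneg, hpos, hfr⟩ := exists_definingFunction hΩ_bounded hΩ_C3
  obtain ⟨r₀, hr₀⟩ := hΩ_bounded.closure.exists_norm_le
  have hM : 0 ≤ ∑ i, M i := Finset.sum_nonneg fun i _ => hM0 i
  -- The motion is built on `[0, T + 1]`, so that right velocities are available at `T`.
  have hS : 0 ≤ T + 1 := by linarith
  obtain ⟨V, hV, hspeed⟩ : ∃ V, 0 ≤ V ∧ ∀ i, ‖v₀ i‖ + (∑ i, M i) * (T + 1) ≤ V :=
    ⟨∑ i, ‖v₀ i‖ + (∑ i, M i) * (T + 1), by positivity, fun i => by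
      gcongr
      exact Finset.single_le_sum (f := fun i => ‖v₀ i‖) (fun j _ => norm_nonneg _)
        (Finset.mem_univ i)⟩
  have hradius : ∀ i, ‖x₀ i‖ + V * (T + 1) ≤ r₀ + V * (T + 1) := fun i => by
    gcongr
    exact hr₀ _ (subset_closure (hx₀ i))
  obtain ⟨L, B, c, hD⟩ := exists_definingBounds hΩ_open hΩ_C3 hφ hneg hpos hfr (r₀ + V * (T + 1))
  have hNc := continuous_gradient hφ
  have hn : ∀ y, c ≤ ‖∇ φ y‖ → (max c ‖∇ φ y‖)⁻¹ • ∇ φ y = ‖∇ φ y‖⁻¹ • ∇ φ y := fun y hy => by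
    rw [max_eq_right hy]
  -- Truncating the denominator at `c` makes the normalised gradient continuous everywhere and
  -- leaves it unchanged wherever reflections occur.
  have hnc : Continuous fun y => (max c ‖∇ φ y‖)⁻¹ • ∇ φ y :=
    ((continuous_const.max hNc.norm).inv₀ fun y => (lt_max_of_lt_left hD.c_pos).ne').smul hNc
  have hnν : ∀ q ∈ frontier Ω, (max c ‖∇ φ q‖)⁻¹ • ∇ φ q = outwardNormal Ω q := by
    intro q hq
    obtain ⟨h0, a, ha, hgrad⟩ := hfr q hq
    have hqΩ : q ∉ Ω := by
      rw [frontier, hΩ_open.interior_eq] at hq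
      exact hq.2
    have hqr : ‖q‖ ≤ r₀ + V * (T + 1) :=
      (hr₀ q (frontier_subset_closure hq)).trans (le_add_of_nonneg_right (by positivity))
    rw [hn q (hD.le_norm q hqr hqΩ (h0.trans_le hD.c_pos.le)), hgrad, norm_smul,
      norm_outwardNormal hΩ_C3 hq, mul_one, Real.norm_eq_abs, abs_of_pos ha, inv_smul_smul₀ ha.ne']
  obtain ⟨C, x, v, R, h⟩ := exists_isImpactMotion (F := fun i t X => G i (t, X)) hS hM hV hΩ_open
    hφ.continuous hD hnc hn hGc (fun i t X => (hGM i _).trans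
      (Finset.single_le_sum (f := M) (fun j _ => hM0 j) (Finset.mem_univ i))) hx₀ hspeed hradius
  refine ⟨x, fun i => ⟨_, _, (h i).2.2.isParticleSolution hT (lt_add_one T) hΩ_open hΩ_C3
    (hφ.differentiable (by norm_num)) hpos hfr hnν hnc ?_ ?_ (h i).1 (h i).2.1 (hx₀ i)⟩⟩
  · exact (hGc i).comp_continuousOn (continuousOn_id.prodMk
      (continuousOn_pi.2 fun j => (h j).2.2.continuousOn_position))
  · intro t ht
    -- Since `φ ≤ 0` along the limit, positions stay in `closure Ω`, where the extended force is the
    -- given one.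
    refine (hGF i (show (t, fun j => x j t) ∈ _ from ⟨ht, fun j => ?_⟩)).symm
    by_contra hc
    exact absurd (hpos _ hc) (not_lt.2 ((h j).2.2.definingFunction_nonpos t
      ⟨ht.1, ht.2.trans (lt_add_one T).le⟩))
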